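/- **Theorem.** Let $(M^m,g)$ and $(N^n,h)$ be smooth Riemannian manifolds and let $\varphi:M\to N$ be a smooth almost submersion, i.e. the set $R\subseteq M$ of regular points (the points $x$ at which $d\varphi_x:T_xM\to T_{\varphi(x)}N$ is surjective) is dense in $M$. For $x\in M$ put $\mathcal V_x=\ker d\varphi_x$ and $\mathcal H_x=\mathcal V_x^{\perp_g}$, and let $g^{\mathcal V}(v,w)=g(v^{\mathcal V},w^{\mathcal V})$ and $g^{\mathcal H}(v,w)=g(v^{\mathcal H},w^{\mathcal H})$, where $v^{\mathcal V}$ and $v^{\mathcal H}$ are the $g$-orthogonal projections of $v$ on $\mathcal V_x$ and $\mathcal H_x$. Let $W\subseteq M$ be an open set with $R\subseteq W$ (for instance $W=M$ or $W=R$), let $\sigma,\rho$ be smooth nowhere vanishing real functions on $W$, and let $\bar g$ be a smooth Riemannian metric on $W$ such that $$\bar g=\sigma^{-2}g^{\mathcal H}+\rho^{-2}g^{\mathcal V}\qquad\text{at every point of } R.$$ Then any two of the following conditions imply the third: 1. $\varphi:(M,g)\to(N,h)$ is harmonic; 2. $\varphi|_W:(W,\bar g)\to(N,h)$ is harmonic;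 3. $\mathrm{grad}^{\mathcal H}\big(\rho^{m-n}\sigma^{n-2}\big)=0$ on $W$, where $\mathrm{grad}^{\mathcal H}f$ is the $\mathcal H$-component of the gradient of $f$ with respect to $g$. Here a smooth map is harmonic if its tension field $\tau(\varphi)=\mathrm{trace}\,\nabla d\varphi$ vanishes identically; in local coordinates $$\tau(\varphi)^a=g^{ij}\big(\partial_i\partial_j\varphi^a-\Gamma^k_{ij}\,\partial_k\varphi^a+\Gamma^a_{bc}(\varphi)\,\partial_i\varphi^b\,\partial_j\varphi^c\big),$$ where $\Gamma^k_{ij}$ and $\Gamma^a_{bc}$ are the Christoffel symbols of the metrics of the domain and of the target. -/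

import Mathlib

open scoped Manifold ContDiff Matrix
open Bundle

namespace AlmostSubmersion

noncomputable section

/-- A field of bilinear forms on the tangent spaces of an `m`-dimensional manifold. -/
abbrev FormField (m : ℕ) (M : Type*) [TopologicalSpace M]
    [ChartedSpace (EuclideanSpace ℝ (Fin m)) M] : Type _ :=
  ∀ x : M, TangentSpace (𝓡 m) x →L[ℝ] TangentSpace (𝓡 m) x →L[ℝ] ℝ

/-- Smooth Riemannian metrics on an `m`-dimensional manifold. -/
abbrev Metric (m : ℕ) (M : Type*) [TopologicalSpace M]
    [ChartedSpace (EuclideanSpace ℝ (Fin m)) M] [IsManifold (𝓡 m) ∞ M] : Type _ :=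
  ContMDiffRiemannianMetric (𝓡 m) ∞ (EuclideanSpace ℝ (Fin m))
    (TangentSpace (𝓡 m) : M → Type)

/-- The field of bilinear forms `G` is a smooth Riemannian metric on the set `W`. -/
structure IsMetricOn {m : ℕ} {M : Type*} [TopologicalSpace M]
    [ChartedSpace (EuclideanSpace ℝ (Fin m)) M] [IsManifold (𝓡 m) ∞ M]
    (G : FormField m M) (W : Set M) : Prop where
  symm : ∀ x ∈ W, ∀ v w : TangentSpace (𝓡 m) x, G x v w = G x w v
  pos : ∀ x ∈ W, ∀ v : TangentSpace (𝓡 m) x, v ≠ 0 → 0 < G x v v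
  smooth : ContMDiffOn (𝓡 m)
    ((𝓡 m).prod 𝓘(ℝ, EuclideanSpace ℝ (Fin m) →L[ℝ] EuclideanSpace ℝ (Fin m) →L[ℝ] ℝ)) ∞
    (fun x : M ↦ TotalSpace.mk'
      (EuclideanSpace ℝ (Fin m) →L[ℝ] EuclideanSpace ℝ (Fin m) →L[ℝ] ℝ)
      (E := fun x : M ↦ TangentSpace (𝓡 m) x →L[ℝ] TangentSpace (𝓡 m) x →L[ℝ] ℝ) x (G x)) W

/-! ### Harmonicity, in local coordinates -/

/-- The `k`-th partial derivative of a function on `ℝᵐ`. -/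
def pd {m : ℕ} (k : Fin m) (f : EuclideanSpace ℝ (Fin m) → ℝ) (y : EuclideanSpace ℝ (Fin m)) : ℝ :=
  fderiv ℝ f y (EuclideanSpace.single k 1)

section Coordinates

variable {m n : ℕ} {M N : Type*}
  [TopologicalSpace M] [ChartedSpace (EuclideanSpace ℝ (Fin m)) M]
  [TopologicalSpace N] [ChartedSpace (EuclideanSpace ℝ (Fin n)) N]

/-- The coordinate vector field `∂/∂xⁱ` of the chart `e`, at the point with coordinates `y`. -/
def coordVec (e : OpenPartialHomeomorph M (EuclideanSpace ℝ (Fin m)))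
    (y : EuclideanSpace ℝ (Fin m)) (i : Fin m) : TangentSpace (𝓡 m) (e.symm y) :=
  mfderiv (𝓡 m) (𝓡 m) e.symm y
    (EuclideanSpace.single i 1 : EuclideanSpace ℝ (Fin m))

/-- The matrix `(g_ij)` of `G` in the chart `e`, at the point with coordinates `y`. -/
def coordMatrix (G : FormField m M) (e : OpenPartialHomeomorph M (EuclideanSpace ℝ (Fin m)))
    (y : EuclideanSpace ℝ (Fin m)) : Matrix (Fin m) (Fin m) ℝ :=
  Matrix.of fun i j ↦ G (e.symm y) (coordVec e y i) (coordVec e y j)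

/-- The Christoffel symbol `Γᵏ_ij = ½ ∑ₗ gᵏˡ (∂ᵢ g_jl + ∂ⱼ g_il - ∂ₗ g_ij)` of `G` in the
chart `e`. -/
def christoffel (G : FormField m M) (e : OpenPartialHomeomorph M (EuclideanSpace ℝ (Fin m)))
    (y : EuclideanSpace ℝ (Fin m)) (k i j : Fin m) : ℝ :=
  (1 / 2) * ∑ l, (coordMatrix G e y)⁻¹ k l *
    (pd i (fun z ↦ coordMatrix G e z j l) y + pd j (fun z ↦ coordMatrix G e z i l) y
      - pd l (fun z ↦ coordMatrix G e z i j) y)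

/-- The `a`-th coordinate of `φ`, read in the charts `e` and `e'`. -/
def coordMap (φ : M → N) (e : OpenPartialHomeomorph M (EuclideanSpace ℝ (Fin m)))
    (e' : OpenPartialHomeomorph N (EuclideanSpace ℝ (Fin n))) (a : Fin n)
    (y : EuclideanSpace ℝ (Fin m)) : ℝ :=
  e' (φ (e.symm y)) a

/-- The `a`-th component, in the charts `e` and `e'`, of the tension field
`τ(φ) = trace_G ∇dφ` of `φ : (M, G) → (N, K)`, at the point with coordinates `y`:
`∑ gⁱʲ (∂ᵢ∂ⱼ φᵃ - Γᵏ_ij ∂ₖ φᵃ + Γᵃ_bc(φ) ∂ᵢ φᵇ ∂ⱼ φᶜ)`. -/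
def tension (G : FormField m M) (K : FormField n N) (φ : M → N)
    (e : OpenPartialHomeomorph M (EuclideanSpace ℝ (Fin m)))
    (e' : OpenPartialHomeomorph N (EuclideanSpace ℝ (Fin n)))
    (y : EuclideanSpace ℝ (Fin m)) (a : Fin n) : ℝ :=
  ∑ i, ∑ j, (coordMatrix G e y)⁻¹ i j *
    (pd i (pd j (coordMap φ e e' a)) y
      - ∑ k, christoffel G e y k i j * pd k (coordMap φ e e' a) y
      + ∑ b, ∑ c, christoffel K e' (e' (φ (e.symm y))) a b c *
          pd i (coordMap φ e e' b) y * pd j (coordMap φ e e' c) y)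

/-- `φ : (M, G) → (N, K)` is harmonic on `W`: its tension field vanishes at the points of `W`,
in all smooth charts. -/
def IsHarmonicOn (G : FormField m M) (K : FormField n N) (φ : M → N) (W : Set M) : Prop :=
  ∀ e ∈ IsManifold.maximalAtlas (𝓡 m) ∞ M, ∀ e' ∈ IsManifold.maximalAtlas (𝓡 n) ∞ N,
    ∀ x ∈ W, x ∈ e.source → φ x ∈ e'.source → ∀ a, tension G K φ e e' (e x) a = 0

/-- The regular points of `φ`, those at which it is submersive. -/
def regularSet (m n : ℕ) {M N : Type*}
    [TopologicalSpace M] [ChartedSpace (EuclideanSpace ℝ (Fin m)) M]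
    [TopologicalSpace N] [ChartedSpace (EuclideanSpace ℝ (Fin n)) N] (φ : M → N) : Set M :=
  {x | Function.Surjective (mfderiv (𝓡 m) (𝓡 n) φ x)}

/-- The vertical space `ker dφₓ`. -/
def vertical (m n : ℕ) {M N : Type*}
    [TopologicalSpace M] [ChartedSpace (EuclideanSpace ℝ (Fin m)) M]
    [TopologicalSpace N] [ChartedSpace (EuclideanSpace ℝ (Fin n)) N] (φ : M → N) (x : M) :
    Submodule ℝ (TangentSpace (𝓡 m) x) :=
  LinearMap.ker (mfderiv (𝓡 m) (𝓡 n) φ x).toLinearMap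

end Coordinates

/-! ### Horizontal and vertical parts, gradient -/

section Metric

variable {m : ℕ} {M : Type*} [TopologicalSpace M]
  [ChartedSpace (EuclideanSpace ℝ (Fin m)) M] [IsManifold (𝓡 m) ∞ M]

/-- The scalar product `gₓ` as a bilinear form. -/
def form (g : Metric m M) (x : M) : LinearMap.BilinForm ℝ (TangentSpace (𝓡 m) x) :=
  LinearMap.mk₂ ℝ (fun v w ↦ g.inner x v w) (by simp) (by simp) (by simp) (by simp)

@[simp] lemma form_apply (g : Metric m M) (x : M) (v w : TangentSpace (𝓡 m) x) :
    form g x v w = g.inner x v w := rfl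

lemma form_isRefl (g : Metric m M) (x : M) : (form g x).IsRefl := by
  intro v w h
  rw [form_apply] at h ⊢
  rw [g.symm, h]

lemma form_self_eq_zero (g : Metric m M) (x : M) {v : TangentSpace (𝓡 m) x}
    (h : g.inner x v v = 0) : v = 0 := by
  by_contra hv
  exact (g.pos x v hv).ne' h

lemma form_nondegenerate (g : Metric m M) (x : M) : (form g x).Nondegenerate :=
  ⟨fun v h ↦ form_self_eq_zero g x (h v), fun v h ↦ form_self_eq_zero g x (h v)⟩

instance finiteDimensional_tangentSpace (x : M) :
    FiniteDimensional ℝ (TangentSpace (𝓡 m) x) :=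
  inferInstanceAs (FiniteDimensional ℝ (EuclideanSpace ℝ (Fin m)))

/-- The `gₓ`-orthogonal complement of a subspace of the tangent space. -/
def orth (g : Metric m M) {x : M} (V : Submodule ℝ (TangentSpace (𝓡 m) x)) :
    Submodule ℝ (TangentSpace (𝓡 m) x) :=
  (form g x).orthogonal V

lemma mem_orth (g : Metric m M) {x : M} (V : Submodule ℝ (TangentSpace (𝓡 m) x))
    (v : TangentSpace (𝓡 m) x) : v ∈ orth g V ↔ ∀ w ∈ V, g.inner x w v = 0 := Iff.rfl

lemma isCompl_orth (g : Metric m M) {x : M} (V : Submodule ℝ (TangentSpace (𝓡 m) x)) :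
    IsCompl V (orth g V) := by
  refine (LinearMap.BilinForm.isCompl_orthogonal_iff_disjoint (form_isRefl g x)).2 ?_
  rw [Submodule.disjoint_def]
  exact fun v hv hv' ↦ form_self_eq_zero g x (hv' v hv)

/-- The orthogonal projection onto `V` with respect to `gₓ`. -/
def orthProj (g : Metric m M) {x : M} (V : Submodule ℝ (TangentSpace (𝓡 m) x)) :
    TangentSpace (𝓡 m) x →ₗ[ℝ] TangentSpace (𝓡 m) x :=
  V.projection (orth g V) (isCompl_orth g V)

/-- The gradient of `f` with respect to `g`. -/
def grad (g : Metric m M) (f : M → ℝ) (x : M) : TangentSpace (𝓡 m) x :=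
  (LinearMap.BilinForm.toDual (form g x) (form_nondegenerate g x)).symm
    (mfderiv (𝓡 m) 𝓘(ℝ, ℝ) f x).toLinearMap

lemma inner_grad (g : Metric m M) (f : M → ℝ) (x : M) (v : TangentSpace (𝓡 m) x) :
    g.inner x (grad g f x) v = (mfderiv (𝓡 m) 𝓘(ℝ, ℝ) f x v : ℝ) :=
  LinearMap.BilinForm.apply_toDual_symm_apply (hB := form_nondegenerate g x) _ v

end Metric

section Biconformal

/-- The vertical part of a tangent vector: its orthogonal projection onto `ker dφₓ`. -/
def verPart (m n : ℕ) {M N : Type*}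
    [TopologicalSpace M] [ChartedSpace (EuclideanSpace ℝ (Fin m)) M] [IsManifold (𝓡 m) ∞ M]
    [TopologicalSpace N] [ChartedSpace (EuclideanSpace ℝ (Fin n)) N]
    (g : Metric m M) (φ : M → N) (x : M) (v : TangentSpace (𝓡 m) x) : TangentSpace (𝓡 m) x :=
  orthProj g (vertical m n φ x) v

/-- The horizontal part of a tangent vector: its orthogonal projection onto `(ker dφₓ)^⊥`. -/
def horPart (m n : ℕ) {M N : Type*}
    [TopologicalSpace M] [ChartedSpace (EuclideanSpace ℝ (Fin m)) M] [IsManifold (𝓡 m) ∞ M]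
    [TopologicalSpace N] [ChartedSpace (EuclideanSpace ℝ (Fin n)) N]
    (g : Metric m M) (φ : M → N) (x : M) (v : TangentSpace (𝓡 m) x) : TangentSpace (𝓡 m) x :=
  orthProj g (orth g (vertical m n φ x)) v

/-- At `x`, the form `G` is `σ⁻² g^H + ρ⁻² g^V`. -/
def IsBiconformalAt (m n : ℕ) {M N : Type*}
    [TopologicalSpace M] [ChartedSpace (EuclideanSpace ℝ (Fin m)) M] [IsManifold (𝓡 m) ∞ M]
    [TopologicalSpace N] [ChartedSpace (EuclideanSpace ℝ (Fin n)) N]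
    (g : Metric m M) (φ : M → N) (σ ρ : M → ℝ) (G : FormField m M) (x : M) : Prop :=
  ∀ v w : TangentSpace (𝓡 m) x, G x v w =
    (σ x ^ 2)⁻¹ * g.inner x (horPart m n g φ x v) (horPart m n g φ x w) +
    (ρ x ^ 2)⁻¹ * g.inner x (verPart m n g φ x v) (verPart m n g φ x w)

/-- On `W`, the horizontal part of the gradient of `ρ^(m-n) σ^(n-2)` vanishes; the exponents are
integers, possibly negative. -/
def HorGradVanishesOn (m n : ℕ) {M N : Type*}
    [TopologicalSpace M] [ChartedSpace (EuclideanSpace ℝ (Fin m)) M] [IsManifold (𝓡 m) ∞ M]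
    [TopologicalSpace N] [ChartedSpace (EuclideanSpace ℝ (Fin n)) N]
    (g : Metric m M) (φ : M → N) (σ ρ : M → ℝ) (W : Set M) : Prop :=
  ∀ x ∈ W, horPart m n g φ x
    (grad g (fun y ↦ ρ y ^ ((m : ℤ) - (n : ℤ)) * σ y ^ ((n : ℤ) - 2)) x) = 0

end Biconformal

end

end AlmostSubmersion

/-!
Away from the critical points everything follows from one identity. Put `F = ρ^(m-n) σ^(n-2)`, and
let `τ`, `τ̄` be the tension fields of `φ` with respect to `g` and `ḡ`. At a regular point
`τ̄ = σ² (τ - dφ(grad log F))` (`tension_biconformal`), so that if two of `τ`, `τ̄`, `dφ(grad F)`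
vanish there, so does the third.

To prove the identity, the tension field is written in divergence form: in a chart
`τᵃ = ∂ᵢ ξⁱ + ½ ξⁱ ∂ᵢ(det g) / det g + gⁱʲ Γᵃ_bc ∂ᵢ φᵇ ∂ⱼ φᶜ` with `ξ = grad φᵃ`
(`tension_eq_divergence`). A biconformal change affects its ingredients in a simple way. The
gradient of `φᵃ` is horizontal, hence is multiplied by `σ²` (`coordGrad_biconformal`); and since
`ker dφ` has dimension `m - n` at a regular point, `√det g` is multiplied by
`C = σ^(-n) ρ^(n-m)`, up to sign (`IsBiconformalAt.det_gram`). As regular points form an open set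
(`isOpen_regularSet`), these relations may be differentiated, and `σ² C = F⁻¹` yields the identity
(`tension_change`).

The regular points are dense, and `τ`, `τ̄` and `dφ(grad F)` are continuous on all of `W`, so their
vanishing extends from the regular points. This is where the condition `grad^H F = 0` has to be
replaced by the equivalent `dφ(grad F) = 0`: the projection onto the horizontal space is not
continuous at critical points, whereas `dφ` is (`horPart_grad_eq_zero_iff`).
-/

namespace AlmostSubmersion

/-! ### Partial derivatives of products, determinants and inverse matrices -/

section PartialDerivatives

variable {m : ℕ} {y : EuclideanSpace ℝ (Fin m)} {f g : EuclideanSpace ℝ (Fin m) → ℝ}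

lemma pd_congr (k : Fin m) (h : f =ᶠ[nhds y] g) : pd k f y = pd k g y := by
  rw [pd, pd, h.fderiv_eq]

lemma pd_const (k : Fin m) (c : ℝ) : pd k (fun _ ↦ c) y = 0 := by
  simp [pd]

lemma pd_mul (k : Fin m) (hf : DifferentiableAt ℝ f y) (hg : DifferentiableAt ℝ g y) :
    pd k (fun z ↦ f z * g z) y = pd k f y * g y + f y * pd k g y := by
  rw [pd, fderiv_fun_mul hf hg]
  simp [pd]
  ring

lemma pd_sum (k : Fin m) {ι : Type*} (s : Finset ι) {F : ι → EuclideanSpace ℝ (Fin m) → ℝ}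
    (hF : ∀ i ∈ s, DifferentiableAt ℝ (F i) y) :
    pd k (fun z ↦ ∑ i ∈ s, F i z) y = ∑ i ∈ s, pd k (F i) y := by
  simp [pd, fderiv_fun_sum hF]

lemma pd_sq (k : Fin m) (hf : DifferentiableAt ℝ f y) :
    pd k (fun z ↦ f z ^ 2) y = 2 * f y * pd k f y := by
  simp only [pow_two]
  rw [pd_mul k hf hf]
  ring

lemma pd_prod (k : Fin m) {ι : Type*} [DecidableEq ι] (s : Finset ι)
    {F : ι → EuclideanSpace ℝ (Fin m) → ℝ} (hF : ∀ i ∈ s, DifferentiableAt ℝ (F i) y) :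
    pd k (fun z ↦ ∏ i ∈ s, F i z) y = ∑ i ∈ s, (∏ j ∈ s.erase i, F j y) * pd k (F i) y := by
  rw [pd, (HasFDerivAt.finsetProd fun i hi ↦ (hF i hi).hasFDerivAt).fderiv]
  simp [pd]

variable {d : ℕ} {A : EuclideanSpace ℝ (Fin m) → Matrix (Fin d) (Fin d) ℝ}

/-- Jacobi's formula, with the adjugate matrix. -/
lemma pd_det (k : Fin m) (hA : ∀ i j, DifferentiableAt ℝ (fun z ↦ A z i j) y) :
    pd k (fun z ↦ (A z).det) y = ∑ i, ∑ j, (A y).adjugate i j * pd k (fun z ↦ A z j i) y := by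
  have h1 (i : Fin d) : ∑ j, (A y).adjugate i j * pd k (fun z ↦ A z j i) y =
      ((A y).updateCol i fun j ↦ pd k (fun z ↦ A z j i) y).det := by
    rw [← Matrix.cramer_apply, Matrix.cramer_eq_adjugate_mulVec]
    rfl
  have hprod (τ : Equiv.Perm (Fin d)) : DifferentiableAt ℝ (fun z ↦ ∏ i, A z (τ i) i) y :=
    (HasFDerivAt.finsetProd fun i _ ↦ (hA (τ i) i).hasFDerivAt).differentiableAt
  simp only [h1, Matrix.det_apply]
  rw [Finset.sum_comm, pd_sum]
  · refine Finset.sum_congr rfl fun τ _ ↦ ?_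
    have h2 : pd k (fun z ↦ ∏ i, A z (τ i) i) y =
        ∑ i, ∏ j, (A y).updateCol i (fun j ↦ pd k (fun z ↦ A z j i) y) (τ j) j := by
      rw [pd_prod k _ fun i _ ↦ hA _ _]
      refine Finset.sum_congr rfl fun i _ ↦ ?_
      rw [← Finset.prod_erase_mul _ _ (Finset.mem_univ i)]
      congr 1
      · refine Finset.prod_congr rfl fun j hj ↦ ?_
        rw [Matrix.updateCol_ne (Finset.ne_of_mem_erase hj)]
      · rw [Matrix.updateCol_self]
    simp only [Units.smul_def, zsmul_eq_mul]
    rw [pd_mul k (by fun_prop) (hprod τ), pd_const,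
      h2, Finset.mul_sum]
    ring
  · intro τ _
    simp only [Units.smul_def, zsmul_eq_mul]
    exact (differentiableAt_const _).mul (hprod τ)

variable {n : WithTop ℕ∞}

lemma contDiffAt_det (hA : ∀ i j, ContDiffAt ℝ n (fun z ↦ A z i j) y) :
    ContDiffAt ℝ n (fun z ↦ (A z).det) y := by
  simp only [Matrix.det_apply, Units.smul_def, zsmul_eq_mul]
  exact ContDiffAt.sum fun τ _ ↦ contDiffAt_const.mul (contDiffAt_prod fun i _ ↦ hA _ _)

lemma contDiffAt_inv_apply (hA : ∀ i j, ContDiffAt ℝ n (fun z ↦ A z i j) y)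
    (hdet : (A y).det ≠ 0) (i j : Fin d) : ContDiffAt ℝ n (fun z ↦ (A z)⁻¹ i j) y := by
  simp only [Matrix.inv_def, Ring.inverse_eq_inv', Matrix.smul_apply, smul_eq_mul,
    Matrix.adjugate_apply]
  refine ((contDiffAt_det hA).inv hdet).mul (contDiffAt_det fun k l ↦ ?_)
  by_cases hk : k = j
  · subst hk
    simpa using contDiffAt_const
  · simpa [Matrix.updateRow_ne hk] using hA k l

lemma pd_inv (k : Fin m) (hA : ∀ i j, ContDiffAt ℝ 1 (fun z ↦ A z i j) y)
    (hdet : (A y).det ≠ 0) (i j : Fin d) :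
    pd k (fun z ↦ (A z)⁻¹ i j) y =
      -∑ a, ∑ b, (A y)⁻¹ i a * pd k (fun z ↦ A z a b) y * (A y)⁻¹ b j := by
  have hinv i j := (contDiffAt_inv_apply hA hdet i j).differentiableAt one_ne_zero
  have hA' i j := (hA i j).differentiableAt one_ne_zero
  have hev : ∀ᶠ z in nhds y, (A z).det ≠ 0 :=
    (contDiffAt_det hA).continuousAt.eventually_ne hdet
  set dI : Matrix (Fin d) (Fin d) ℝ := Matrix.of fun i j ↦ pd k (fun z ↦ (A z)⁻¹ i j) y with hdI
  set dA : Matrix (Fin d) (Fin d) ℝ := Matrix.of fun i j ↦ pd k (fun z ↦ A z i j) y with hdA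
  have h1 : dI * A y + (A y)⁻¹ * dA = 0 := by
    ext a c
    have h2 : pd k (fun z ↦ ∑ b, (A z)⁻¹ a b * A z b c) y = 0 := by
      rw [← pd_const (y := y) k ((1 : Matrix (Fin d) (Fin d) ℝ) a c)]
      refine pd_congr k (hev.mono fun z hz ↦ ?_)
      have := congrFun (congrFun (Matrix.nonsing_inv_mul (A z) (isUnit_iff_ne_zero.2 hz)) a) c
      simpa only [Matrix.mul_apply] using this
    rw [pd_sum k _ fun b _ ↦ (hinv a b).fun_mul (hA' b c)] at h2
    simp only [pd_mul k (hinv _ _) (hA' _ _), Finset.sum_add_distrib] at h2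
    simpa [Matrix.mul_apply, hdI, hdA] using h2
  have h3 : dI = -((A y)⁻¹ * dA * (A y)⁻¹) := by
    have h4 := congrArg (· * (A y)⁻¹) h1
    simp only [add_mul, zero_mul,
      Matrix.mul_nonsing_inv_cancel_right _ _ (isUnit_iff_ne_zero.2 hdet)] at h4
    exact eq_neg_of_add_eq_zero_left h4
  have h5 := congrFun (congrFun h3 i) j
  simp only [hdI, hdA, Matrix.of_apply, Matrix.neg_apply, Matrix.mul_apply, Finset.sum_mul] at h5
  rw [h5, Finset.sum_comm]

end PartialDerivatives

/-! ### The tension field in divergence form -/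

section Tension

variable {m n : ℕ} {M N : Type*}
  [TopologicalSpace M] [ChartedSpace (EuclideanSpace ℝ (Fin m)) M]
  [TopologicalSpace N] [ChartedSpace (EuclideanSpace ℝ (Fin n)) N]

/-- The `i`-th component `ξⁱ = ∑ⱼ gⁱʲ ∂ⱼ u` of the gradient, with respect to `G`, of a function `u`
given in the chart `e`. -/
noncomputable def coordGrad (G : FormField m M)
    (e : OpenPartialHomeomorph M (EuclideanSpace ℝ (Fin m)))
    (u : EuclideanSpace ℝ (Fin m) → ℝ) (i : Fin m) (y : EuclideanSpace ℝ (Fin m)) : ℝ :=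
  ∑ j, (coordMatrix G e y)⁻¹ i j * pd j u y

variable {G : FormField m M} {e : OpenPartialHomeomorph M (EuclideanSpace ℝ (Fin m))}
  {y : EuclideanSpace ℝ (Fin m)} {u : EuclideanSpace ℝ (Fin m) → ℝ}

/-- The trace of the Hessian is the divergence of the gradient:
`gⁱʲ (∂ᵢ∂ⱼ u - Γᵏ_ij ∂ₖ u) = ∂ᵢ ξⁱ + ½ ξⁱ ∂ᵢ(det g) / det g`. -/
lemma trace_hessian_eq_divergence
    (hG : ∀ i j, ContDiffAt ℝ 1 (fun z ↦ coordMatrix G e z i j) y)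
    (hsymm : (coordMatrix G e y).IsSymm) (hdet : (coordMatrix G e y).det ≠ 0)
    (hu : ∀ j, DifferentiableAt ℝ (pd j u) y) :
    ∑ i, ∑ j, (coordMatrix G e y)⁻¹ i j *
        (pd i (pd j u) y - ∑ k, christoffel G e y k i j * pd k u y) =
      ∑ i, pd i (coordGrad G e u i) y + 1 / 2 * ∑ i, coordGrad G e u i y *
        (pd i (fun z ↦ (coordMatrix G e z).det) y / (coordMatrix G e y).det) := by
  have hinv i j := (contDiffAt_inv_apply hG hdet i j).differentiableAt one_ne_zero
  have hjac (i : Fin m) : pd i (fun z ↦ (coordMatrix G e z).det) y / (coordMatrix G e y).det =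
      ∑ a, ∑ b, (coordMatrix G e y)⁻¹ a b * pd i (fun z ↦ coordMatrix G e z b a) y := by
    rw [pd_det i fun i j ↦ (hG i j).differentiableAt one_ne_zero, Finset.sum_div]
    refine Finset.sum_congr rfl fun a _ ↦ ?_
    rw [Finset.sum_div]
    refine Finset.sum_congr rfl fun b _ ↦ ?_
    simp only [Matrix.inv_def, Ring.inverse_eq_inv', Matrix.smul_apply, smul_eq_mul]
    ring
  have hdiv (i : Fin m) : pd i (coordGrad G e u i) y =
      ∑ j, (pd i (fun z ↦ (coordMatrix G e z)⁻¹ i j) y * pd j u y +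
        (coordMatrix G e y)⁻¹ i j * pd i (pd j u) y) := by
    unfold coordGrad
    rw [pd_sum i _ fun j _ ↦ (hinv i j).fun_mul (hu j)]
    exact Finset.sum_congr rfl fun j _ ↦ pd_mul i (hinv i j) (hu j)
  simp only [hjac, hdiv, pd_inv _ hG hdet]
  have hHsymm (i j : Fin m) : (coordMatrix G e y)⁻¹ i j = (coordMatrix G e y)⁻¹ j i := by
    have : ((coordMatrix G e y)⁻¹)ᵀ = (coordMatrix G e y)⁻¹ := by
      rw [Matrix.transpose_nonsing_inv, hsymm.eq]
    exact congrFun (congrFun this j) i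
  -- From here on the identity is algebraic in `H = g⁻¹`, `D k = ∂ₖ g` and `w = du`.
  simp only [coordGrad, christoffel]
  generalize (coordMatrix G e y)⁻¹ = H at hHsymm ⊢
  generalize hD : (fun k i j ↦ pd k (fun z ↦ coordMatrix G e z i j) y) = D
  replace hD k i j : pd k (fun z ↦ coordMatrix G e z i j) y = D k i j := by rw [← hD]
  simp only [hD]
  generalize hw : (fun k ↦ pd k u y) = w
  replace hw k : pd k u y = w k := by rw [← hw]
  simp only [hw]
  clear hD hw hdiv hjac hinv
  set ξ : Fin m → ℝ := fun l ↦ ∑ j, H l j * w j with hξ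
  have hΓ : ∑ i, ∑ j, H i j * ∑ k, (1 / 2 * ∑ l, H k l * (D i j l + D j i l - D l i j)) * w k =
      1 / 2 * (∑ i, ∑ j, ∑ l, H i j * D i j l * ξ l + ∑ i, ∑ j, ∑ l, H i j * D j i l * ξ l -
        ∑ i, ∑ j, ∑ l, H i j * D l i j * ξ l) := by
    simp only [← Finset.sum_add_distrib, ← Finset.sum_sub_distrib, Finset.mul_sum]
    refine Finset.sum_congr rfl fun i _ ↦ Finset.sum_congr rfl fun j _ ↦ ?_
    simp only [hξ, Finset.mul_sum, Finset.sum_mul, ← Finset.sum_add_distrib,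
      ← Finset.sum_sub_distrib]
    rw [Finset.sum_comm]
    refine Finset.sum_congr rfl fun l _ ↦ Finset.sum_congr rfl fun k _ ↦ ?_
    rw [hHsymm k l]
    ring
  have hswap : ∑ i, ∑ j, ∑ l, H i j * D j i l * ξ l = ∑ i, ∑ j, ∑ l, H i j * D i j l * ξ l := by
    rw [Finset.sum_comm]
    exact Finset.sum_congr rfl fun i _ ↦ Finset.sum_congr rfl fun j _ ↦ by simp only [hHsymm i j]
  have hdI (i : Fin m) : ∑ j, -(∑ a, ∑ b, H i a * D i a b * H b j) * w j =
      -∑ a, ∑ b, H i a * D i a b * ξ b := by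
    simp only [hξ, neg_mul, Finset.sum_neg_distrib, Finset.sum_mul, Finset.mul_sum]
    rw [Finset.sum_comm]
    refine congrArg _ (Finset.sum_congr rfl fun a _ ↦ ?_)
    rw [Finset.sum_comm]
    exact Finset.sum_congr rfl fun b _ ↦ Finset.sum_congr rfl fun j _ ↦ by ring
  have htr : ∑ i, (∑ j, H i j * w j) * ∑ a, ∑ b, H a b * D i b a =
      ∑ i, ∑ j, ∑ l, H i j * D l i j * ξ l := by
    have (i : Fin m) : (∑ j, H i j * w j) * ∑ a, ∑ b, H a b * D i b a =
        ∑ b, ∑ a, H b a * D i b a * ξ i := by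
      rw [Finset.sum_comm, Finset.mul_sum]
      refine Finset.sum_congr rfl fun b _ ↦ ?_
      rw [Finset.mul_sum]
      refine Finset.sum_congr rfl fun a _ ↦ ?_
      rw [hHsymm a b, mul_comm]
    simp only [this]
    rw [Finset.sum_comm]
    exact Finset.sum_congr rfl fun b _ ↦ Finset.sum_comm
  have hsplit (X Y : Fin m → Fin m → ℝ) : ∑ i, ∑ j, H i j * (X i j - Y i j) =
      ∑ i, ∑ j, H i j * X i j - ∑ i, ∑ j, H i j * Y i j := by
    simp only [mul_sub, Finset.sum_sub_distrib]
  rw [hsplit, hΓ, hswap, htr]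
  simp only [Finset.sum_add_distrib, hdI, Finset.sum_neg_distrib]
  ring

/-- The tension field in divergence form; in the last term, `gⁱʲ ∂ᵢ φᵇ ∂ⱼ φᶜ` is the derivative of
`φᵇ` along the gradient of `φᶜ`. -/
lemma tension_eq_divergence {K : FormField n N} {φ : M → N}
    {e' : OpenPartialHomeomorph N (EuclideanSpace ℝ (Fin n))}
    (hG : ∀ i j, ContDiffAt ℝ 1 (fun z ↦ coordMatrix G e z i j) y)
    (hsymm : (coordMatrix G e y).IsSymm) (hdet : (coordMatrix G e y).det ≠ 0)
    (hφ : ∀ a j, DifferentiableAt ℝ (pd j (coordMap φ e e' a)) y) (a : Fin n) :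
    tension G K φ e e' y a =
      ∑ i, pd i (coordGrad G e (coordMap φ e e' a) i) y +
      1 / 2 * ∑ i, coordGrad G e (coordMap φ e e' a) i y *
        (pd i (fun z ↦ (coordMatrix G e z).det) y / (coordMatrix G e y).det) +
      ∑ b, ∑ c, christoffel K e' (e' (φ (e.symm y))) a b c *
        ∑ i, pd i (coordMap φ e e' b) y * coordGrad G e (coordMap φ e e' c) i y := by
  rw [← trace_hessian_eq_divergence hG hsymm hdet (hφ a), tension]
  simp only [mul_add, Finset.sum_add_distrib]
  congr 1
  simp only [coordGrad, Finset.mul_sum]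
  have (i : Fin m) : ∑ j, ∑ b, ∑ c, (coordMatrix G e y)⁻¹ i j *
      (christoffel K e' (e' (φ (e.symm y))) a b c * pd i (coordMap φ e e' b) y *
        pd j (coordMap φ e e' c) y) =
      ∑ b, ∑ c, ∑ j, christoffel K e' (e' (φ (e.symm y))) a b c *
        (pd i (coordMap φ e e' b) y *
          ((coordMatrix G e y)⁻¹ i j * pd j (coordMap φ e e' c) y)) := by
    rw [Finset.sum_comm]
    refine Finset.sum_congr rfl fun b _ ↦ ?_
    rw [Finset.sum_comm]
    exact Finset.sum_congr rfl fun c _ ↦ Finset.sum_congr rfl fun j _ ↦ by ring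
  simp only [this]
  rw [Finset.sum_comm]
  exact Finset.sum_congr rfl fun b _ ↦ Finset.sum_comm

/-- Change of the tension field: if the metric changes so that the gradients of the components of
`φ` are multiplied by `s²` and the volume density, up to sign, by `c`, then
`τ̄ = s² (τ + dφ(grad log (s² c)))`. -/
lemma tension_change {G' : FormField m M} {K : FormField n N} {φ : M → N}
    {e' : OpenPartialHomeomorph N (EuclideanSpace ℝ (Fin n))}
    (hG : ∀ i j, ContDiffAt ℝ 1 (fun z ↦ coordMatrix G e z i j) y)
    (hsymm : (coordMatrix G e y).IsSymm) (hdet : (coordMatrix G e y).det ≠ 0)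
    (hG' : ∀ i j, ContDiffAt ℝ 1 (fun z ↦ coordMatrix G' e z i j) y)
    (hsymm' : (coordMatrix G' e y).IsSymm) (hdet' : (coordMatrix G' e y).det ≠ 0)
    (hφ : ∀ a j, DifferentiableAt ℝ (pd j (coordMap φ e e' a)) y)
    {s c : EuclideanSpace ℝ (Fin m) → ℝ} (hs : DifferentiableAt ℝ s y)
    (hc : DifferentiableAt ℝ c y) (hs0 : s y ≠ 0) (hc0 : c y ≠ 0)
    (hgrad : ∀ a i, ∀ᶠ z in nhds y, coordGrad G' e (coordMap φ e e' a) i z =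
      s z ^ 2 * coordGrad G e (coordMap φ e e' a) i z)
    (hvol : ∀ᶠ z in nhds y, (coordMatrix G' e z).det = c z ^ 2 * (coordMatrix G e z).det)
    (a : Fin n) :
    tension G' K φ e e' y a = s y ^ 2 * (tension G K φ e e' y a +
      (s y ^ 2 * c y)⁻¹ * ∑ i, coordGrad G e (coordMap φ e e' a) i y *
        pd i (fun z ↦ s z ^ 2 * c z) y) := by
  have hinv i j := (contDiffAt_inv_apply hG hdet i j).differentiableAt one_ne_zero
  have hξ (i : Fin m) : DifferentiableAt ℝ (coordGrad G e (coordMap φ e e' a) i) y :=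
    DifferentiableAt.fun_sum fun j _ ↦ (hinv i j).fun_mul (hφ a j)
  have hD : DifferentiableAt ℝ (fun z ↦ (coordMatrix G e z).det) y :=
    (contDiffAt_det hG).differentiableAt one_ne_zero
  have h1 (i : Fin m) : pd i (coordGrad G' e (coordMap φ e e' a) i) y =
      2 * s y * pd i s y * coordGrad G e (coordMap φ e e' a) i y +
        s y ^ 2 * pd i (coordGrad G e (coordMap φ e e' a) i) y := by
    rw [pd_congr i (hgrad a i), pd_mul i (hs.fun_pow 2) (hξ i), pd_sq i hs]
  have h2 (i : Fin m) : pd i (fun z ↦ (coordMatrix G' e z).det) y / (coordMatrix G' e y).det =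
      2 * (pd i c y / c y) +
        pd i (fun z ↦ (coordMatrix G e z).det) y / (coordMatrix G e y).det := by
    rw [pd_congr i hvol, pd_mul i (hc.fun_pow 2) hD, pd_sq i hc, hvol.self_of_nhds]
    field_simp
  have h3 (a : Fin n) (i : Fin m) := (hgrad a i).self_of_nhds
  have h4 (i : Fin m) : pd i (fun z ↦ s z ^ 2 * c z) y =
      2 * s y * pd i s y * c y + s y ^ 2 * pd i c y := by
    rw [pd_mul i (hs.fun_pow 2) hc, pd_sq i hs]
  rw [tension_eq_divergence hG hsymm hdet hφ, tension_eq_divergence hG' hsymm' hdet' hφ]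
  simp only [h1, h2, h3, h4]
  have h5 : ∑ b, ∑ d, christoffel K e' (e' (φ (e.symm y))) a b d *
        ∑ i, pd i (coordMap φ e e' b) y * (s y ^ 2 * coordGrad G e (coordMap φ e e' d) i y) =
      s y ^ 2 * ∑ b, ∑ d, christoffel K e' (e' (φ (e.symm y))) a b d *
        ∑ i, pd i (coordMap φ e e' b) y * coordGrad G e (coordMap φ e e' d) i y := by
    simp only [Finset.mul_sum]
    exact Finset.sum_congr rfl fun b _ ↦ Finset.sum_congr rfl fun d _ ↦
      Finset.sum_congr rfl fun i _ ↦ by ring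
  have h6 : ∑ i, (2 * s y * pd i s y * coordGrad G e (coordMap φ e e' a) i y +
        s y ^ 2 * pd i (coordGrad G e (coordMap φ e e' a) i) y) +
      1 / 2 * ∑ i, s y ^ 2 * coordGrad G e (coordMap φ e e' a) i y * (2 * (pd i c y / c y) +
        pd i (fun z ↦ (coordMatrix G e z).det) y / (coordMatrix G e y).det) =
      s y ^ 2 * (∑ i, pd i (coordGrad G e (coordMap φ e e' a) i) y +
      1 / 2 * ∑ i, coordGrad G e (coordMap φ e e' a) i y *
        (pd i (fun z ↦ (coordMatrix G e z).det) y / (coordMatrix G e y).det) +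
      (s y ^ 2 * c y)⁻¹ * ∑ i, coordGrad G e (coordMap φ e e' a) i y *
        (2 * s y * pd i s y * c y + s y ^ 2 * pd i c y)) := by
    simp only [Finset.mul_sum, ← Finset.sum_add_distrib]
    refine Finset.sum_congr rfl fun i _ ↦ ?_
    field_simp
    ring
  linear_combination h5 + h6

end Tension

/-! ### Linear algebra of biconformal changes -/

/-- The determinant of the map acting as `a` on `P` and as `b` on a complement `Q` of `P`. -/
lemma det_smul_projection_add_smul_projection {E : Type*} [AddCommGroup E] [Module ℝ E]
    [FiniteDimensional ℝ E] {P Q : Submodule ℝ E} (hPQ : IsCompl P Q) (a b : ℝ) :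
    LinearMap.det (a • P.projection Q hPQ + b • Q.projection P hPQ.symm) =
      a ^ Module.finrank ℝ P * b ^ Module.finrank ℝ Q := by
  have h : a • P.projection Q hPQ + b • Q.projection P hPQ.symm =
      (P.prodEquivOfIsCompl Q hPQ : P × Q →ₗ[ℝ] E) ∘ₗ
        LinearMap.prodMap (a • LinearMap.id) (b • LinearMap.id) ∘ₗ
          ((P.prodEquivOfIsCompl Q hPQ).symm : E →ₗ[ℝ] P × Q) := by
    refine LinearMap.ext fun x ↦ ?_
    obtain ⟨z, rfl⟩ := (P.prodEquivOfIsCompl Q hPQ).surjective x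
    rw [LinearMap.comp_apply, LinearMap.comp_apply, LinearEquiv.coe_coe, LinearEquiv.coe_coe,
      LinearEquiv.symm_apply_apply, Submodule.coe_prodEquivOfIsCompl',
      Submodule.coe_prodEquivOfIsCompl']
    simp
  rw [h, LinearMap.det_conj, LinearMap.det_prodMap, LinearMap.det_smul, LinearMap.det_smul]
  simp

section Metric

variable {m n : ℕ} {M N : Type*} [TopologicalSpace M]
  [ChartedSpace (EuclideanSpace ℝ (Fin m)) M] [IsManifold (𝓡 m) ∞ M]
  [TopologicalSpace N] [ChartedSpace (EuclideanSpace ℝ (Fin n)) N]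
  (g : Metric m M) {φ : M → N} {σ ρ : M → ℝ} {G : FormField m M} {x : M}

lemma finrank_tangentSpace {m : ℕ} {M : Type*} [TopologicalSpace M]
    [ChartedSpace (EuclideanSpace ℝ (Fin m)) M] (x : M) :
    Module.finrank ℝ (TangentSpace (𝓡 m) x) = m :=
  finrank_euclideanSpace_fin

lemma orth_orth (V : Submodule ℝ (TangentSpace (𝓡 m) x)) : orth g (orth g V) = V :=
  LinearMap.BilinForm.orthogonal_orthogonal (form_nondegenerate g x) (form_isRefl g x) V

lemma projection_congr {E : Type*} [AddCommGroup E] [Module ℝ E] {P Q Q' : Submodule ℝ E}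
    (h : Q = Q') (hQ : IsCompl P Q) (hQ' : IsCompl P Q') :
    P.projection Q hQ = P.projection Q' hQ' := by
  subst h
  rfl

lemma orthProj_orth (V : Submodule ℝ (TangentSpace (𝓡 m) x)) :
    orthProj g (orth g V) = (orth g V).projection V (isCompl_orth g V).symm :=
  projection_congr (orth_orth g V) _ _

lemma horPart_add_verPart (v : TangentSpace (𝓡 m) x) :
    horPart m n g φ x v + verPart m n g φ x v = v := by
  rw [horPart, verPart, orthProj_orth, add_comm]
  exact Submodule.projection_add_projection_eq_self (isCompl_orth g _) v

lemma horPart_mem (v : TangentSpace (𝓡 m) x) :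
    horPart m n g φ x v ∈ orth g (vertical m n φ x) := by
  rw [horPart, orthProj]
  exact Submodule.projection_apply_mem _ v

lemma verPart_mem (v : TangentSpace (𝓡 m) x) : verPart m n g φ x v ∈ vertical m n φ x := by
  rw [verPart, orthProj]
  exact Submodule.projection_apply_mem _ v

lemma horPart_eq_zero_iff {v : TangentSpace (𝓡 m) x} :
    horPart m n g φ x v = 0 ↔ mfderiv (𝓡 m) (𝓡 n) φ x v = 0 := by
  rw [horPart, orthProj_orth]
  exact Submodule.projection_apply_eq_zero_iff (isCompl_orth g _).symm

lemma inner_horPart_verPart (v w : TangentSpace (𝓡 m) x) :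
    g.inner x (horPart m n g φ x v) (verPart m n g φ x w) = 0 := by
  rw [g.symm]
  exact horPart_mem g v _ (verPart_mem g w)

/-- On a horizontal vector, a biconformal change of metric is multiplication by `σ⁻²`. -/
lemma IsBiconformalAt.apply_of_mem_orth (hG : IsBiconformalAt m n g φ σ ρ G x)
    {v : TangentSpace (𝓡 m) x} (hv : v ∈ orth g (vertical m n φ x)) (w : TangentSpace (𝓡 m) x) :
    G x v w = (σ x ^ 2)⁻¹ * g.inner x v w := by
  have h1 : horPart m n g φ x v = v := by
    rw [horPart, orthProj]
    exact Submodule.projection_apply_of_mem_left _ hv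
  have h2 : verPart m n g φ x v = 0 := by
    simpa [h1] using horPart_add_verPart (n := n) (φ := φ) g v
  have h3 : g.inner x v w = g.inner x v (horPart m n g φ x w) := by
    conv_lhs => rw [← horPart_add_verPart (n := n) (φ := φ) g w, map_add, ← h1,
      inner_horPart_verPart, add_zero, h1]
  rw [hG v w, h1, h2, h3]
  simp

/-- The Gram determinants of a biconformal change: the volume density is multiplied by
`σ⁻ⁿ ρ^(n-m)` at a regular point. -/
lemma IsBiconformalAt.det_gram (hG : IsBiconformalAt m n g φ σ ρ G x)
    (hx : x ∈ regularSet m n φ)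
    (b : Module.Basis (Fin m) ℝ (TangentSpace (𝓡 m) x)) :
    (Matrix.of fun i j ↦ G x (b i) (b j)).det =
      (σ x ^ (-n : ℤ) * ρ x ^ ((n : ℤ) - m)) ^ 2 *
        (Matrix.of fun i j ↦ g.inner x (b i) (b j)).det := by
  set V := vertical m n φ x
  set T : TangentSpace (𝓡 m) x →ₗ[ℝ] TangentSpace (𝓡 m) x :=
    (ρ x ^ 2)⁻¹ • V.projection (orth g V) (isCompl_orth g V) +
      (σ x ^ 2)⁻¹ • (orth g V).projection V (isCompl_orth g V).symm with hT
  have hTG (v w : TangentSpace (𝓡 m) x) : G x v w = (form g x).compLeft T v w := by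
    have h1 : T v = (ρ x ^ 2)⁻¹ • verPart m n g φ x v + (σ x ^ 2)⁻¹ • horPart m n g φ x v := by
      rw [horPart, orthProj_orth]
      rfl
    have h2 : g.inner x (horPart m n g φ x v) w =
        g.inner x (horPart m n g φ x v) (horPart m n g φ x w) := by
      conv_lhs => rw [← horPart_add_verPart (n := n) (φ := φ) g w, map_add,
        inner_horPart_verPart, add_zero]
    have h3 : g.inner x (verPart m n g φ x v) w =
        g.inner x (verPart m n g φ x v) (verPart m n g φ x w) := by
      conv_lhs => rw [← horPart_add_verPart (n := n) (φ := φ) g w, map_add,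
        g.symm x _ (horPart m n g φ x w), inner_horPart_verPart, zero_add]
    rw [hG v w, LinearMap.BilinForm.compLeft_apply, form_apply, h1]
    simp only [map_add, map_smul, add_apply, smul_apply,
      smul_eq_mul, h2, h3]
    ring
  have hgram : (Matrix.of fun i j ↦ G x (b i) (b j)) =
      LinearMap.BilinForm.toMatrix b ((form g x).compLeft T) := by
    ext i j
    rw [LinearMap.BilinForm.toMatrix_apply, Matrix.of_apply, hTG]
  have hgram' : (Matrix.of fun i j ↦ g.inner x (b i) (b j)) =
      LinearMap.BilinForm.toMatrix b (form g x) := by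
    ext i j
    rw [LinearMap.BilinForm.toMatrix_apply, Matrix.of_apply, form_apply]
  have hrank : n + Module.finrank ℝ V = m := by
    have := LinearMap.finrank_range_add_finrank_ker (mfderiv (𝓡 m) (𝓡 n) φ x).toLinearMap
    rwa [LinearMap.range_eq_top.2 hx, finrank_top, finrank_tangentSpace,
      finrank_tangentSpace] at this
  have hrank' : Module.finrank ℝ (orth g V) = n := by
    have := Submodule.finrank_add_eq_of_isCompl (isCompl_orth g V)
    rw [finrank_tangentSpace] at this
    omega
  rw [hgram, hgram', LinearMap.BilinForm.toMatrix_compLeft, Matrix.det_mul, Matrix.det_transpose,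
    LinearMap.det_toMatrix, hT, det_smul_projection_add_smul_projection, hrank']
  congr 1
  have h5 : (n : ℤ) - m = -(Module.finrank ℝ V : ℤ) := by omega
  rw [h5]
  simp only [zpow_neg, zpow_natCast]
  rw [mul_pow, inv_pow, inv_pow, inv_pow, inv_pow, ← pow_mul, ← pow_mul, ← pow_mul, ← pow_mul,
    mul_comm 2, mul_comm 2, mul_comm]

end Metric

/-! ### Smoothness in charts -/

section Charts

lemma isOpen_setOf_surjective {E F : Type*} [NormedAddCommGroup E] [NormedSpace ℝ E]
    [NormedAddCommGroup F] [NormedSpace ℝ F] [FiniteDimensional ℝ F] :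
    IsOpen {L : E →L[ℝ] F | Function.Surjective L} := by
  rw [isOpen_iff_mem_nhds]
  intro L hL
  have : CompleteSpace F := FiniteDimensional.complete ℝ F
  obtain ⟨S, hS⟩ := (L : E →ₗ[ℝ] F).exists_rightInverse_of_surjective (LinearMap.range_eq_top.2 hL)
  -- The maps `L'` such that `L' ∘ S` is invertible form a neighbourhood of `L`.
  set S' : F →L[ℝ] E := S.toContinuousLinearMap with hS'
  have h1 : L.comp S' = 1 := by
    ext v
    exact LinearMap.congr_fun hS v
  have h2 : Continuous fun L' : E →L[ℝ] F ↦ L'.comp S' :=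
    continuous_id.clm_comp continuous_const
  have h3 : {T : F →L[ℝ] F | IsUnit T} ∈ nhds (L.comp S') := by
    rw [h1]
    exact Units.isOpen.mem_nhds isUnit_one
  filter_upwards [h2.continuousAt h3] with L' hL' w
  obtain ⟨T, hT⟩ := hL'
  have h4 : (T.1 * (T⁻¹).1) w = w := by rw [Units.mul_inv]; rfl
  rw [hT] at h4
  exact ⟨S' ((T⁻¹).1 w), h4⟩

lemma contDiffAt_pd {m : ℕ} {u : EuclideanSpace ℝ (Fin m) → ℝ} {y : EuclideanSpace ℝ (Fin m)}
    (hu : ContDiffAt ℝ ∞ u y) (k : Fin m) : ContDiffAt ℝ ∞ (pd k u) y :=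
  (hu.fderiv_right (m := ∞) (by simp)).clm_apply contDiffAt_const

variable {m n : ℕ} {M N : Type*}
  [TopologicalSpace M] [ChartedSpace (EuclideanSpace ℝ (Fin m)) M]
  [TopologicalSpace N] [ChartedSpace (EuclideanSpace ℝ (Fin n)) N]
  {e : OpenPartialHomeomorph M (EuclideanSpace ℝ (Fin m))}
  {e' : OpenPartialHomeomorph N (EuclideanSpace ℝ (Fin n))}
  {y : EuclideanSpace ℝ (Fin m)} {φ : M → N}

lemma mdifferentiable_of_mem_maximalAtlas (he : e ∈ IsManifold.maximalAtlas (𝓡 m) ∞ M) :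
    e.MDifferentiable (𝓡 m) (𝓡 m) :=
  ⟨(contMDiffOn_of_mem_maximalAtlas he).mdifferentiableOn (by simp),
    (contMDiffOn_symm_of_mem_maximalAtlas he).mdifferentiableOn (by simp)⟩

/-- The coordinate vector fields of a chart, as a basis of the tangent space. -/
noncomputable def coordBasis (he : e ∈ IsManifold.maximalAtlas (𝓡 m) ∞ M) (hy : y ∈ e.target) :
    Module.Basis (Fin m) ℝ (TangentSpace (𝓡 m) (e.symm y)) :=
  (EuclideanSpace.basisFun (Fin m) ℝ).toBasis.map
    ((mdifferentiable_of_mem_maximalAtlas he).symm.mfderiv (x := y) hy).toLinearEquiv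

lemma coordBasis_apply (he : e ∈ IsManifold.maximalAtlas (𝓡 m) ∞ M) (hy : y ∈ e.target)
    (i : Fin m) : coordBasis he hy i = coordVec e y i :=
  congrArg (mfderiv (𝓡 m) (𝓡 m) e.symm y)
    ((congrFun (EuclideanSpace.basisFun (Fin m) ℝ).coe_toBasis i).trans
      (EuclideanSpace.basisFun_apply (Fin m) ℝ i))

lemma contDiffAt_comp_symm {W : Set M} (hW : IsOpen W) {f : M → ℝ}
    (hf : ContMDiffOn (𝓡 m) 𝓘(ℝ, ℝ) ∞ f W) (he : e ∈ IsManifold.maximalAtlas (𝓡 m) ∞ M)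
    (hy : y ∈ e.target) (hyW : e.symm y ∈ W) : ContDiffAt ℝ ∞ (f ∘ e.symm) y :=
  ((hf.contMDiffAt (hW.mem_nhds hyW)).comp y
    (contMDiffAt_symm_of_mem_maximalAtlas he hy)).contDiffAt

lemma pd_comp_symm {f : M → ℝ} (he : e ∈ IsManifold.maximalAtlas (𝓡 m) ∞ M) (hy : y ∈ e.target)
    (hf : MDifferentiableAt (𝓡 m) 𝓘(ℝ, ℝ) f (e.symm y)) (i : Fin m) :
    pd i (f ∘ e.symm) y = mfderiv (𝓡 m) 𝓘(ℝ, ℝ) f (e.symm y) (coordVec e y i) := by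
  rw [pd, ← mfderiv_eq_fderiv, mfderiv_comp y hf
    ((mdifferentiable_of_mem_maximalAtlas he).mdifferentiableAt_symm hy)]
  rfl

lemma contMDiffAt_coord (hφ : ContMDiff (𝓡 m) (𝓡 n) ∞ φ)
    (he' : e' ∈ IsManifold.maximalAtlas (𝓡 n) ∞ N) {x : M} (hx : φ x ∈ e'.source) (a : Fin n) :
    ContMDiffAt (𝓡 m) 𝓘(ℝ, ℝ) ∞ (fun z ↦ e' (φ z) a) x := by
  have h1 : ContMDiffAt (𝓡 m) (𝓡 n) ∞ (e' ∘ φ) x :=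
    (contMDiffAt_of_mem_maximalAtlas he' hx).comp x hφ.contMDiffAt
  exact (EuclideanSpace.proj (𝕜 := ℝ) a).contMDiff.contMDiffAt.comp x h1

lemma contDiffAt_coordMap (hφ : ContMDiff (𝓡 m) (𝓡 n) ∞ φ)
    (he : e ∈ IsManifold.maximalAtlas (𝓡 m) ∞ M) (hy : y ∈ e.target)
    (he' : e' ∈ IsManifold.maximalAtlas (𝓡 n) ∞ N) (hx : φ (e.symm y) ∈ e'.source) (a : Fin n) :
    ContDiffAt ℝ ∞ (coordMap φ e e' a) y :=
  ((contMDiffAt_coord hφ he' hx a).comp y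
    (contMDiffAt_symm_of_mem_maximalAtlas he hy)).contDiffAt

lemma mfderiv_coord (hφ : ContMDiff (𝓡 m) (𝓡 n) ∞ φ)
    (he' : e' ∈ IsManifold.maximalAtlas (𝓡 n) ∞ N) {x : M} (hx : φ x ∈ e'.source) (a : Fin n)
    (v : TangentSpace (𝓡 m) x) :
    mfderiv (𝓡 m) 𝓘(ℝ, ℝ) (fun z ↦ e' (φ z) a) x v =
      (EuclideanSpace.proj a : EuclideanSpace ℝ (Fin n) →L[ℝ] ℝ)
        (mfderiv (𝓡 n) (𝓡 n) e' (φ x) (mfderiv (𝓡 m) (𝓡 n) φ x v)) := by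
  have h1 : MDifferentiableAt (𝓡 n) (𝓡 n) e' (φ x) :=
    (mdifferentiable_of_mem_maximalAtlas he').mdifferentiableAt hx
  have h2 : MDifferentiableAt (𝓡 m) (𝓡 n) φ x := hφ.mdifferentiableAt (by simp)
  have h3 := ((EuclideanSpace.proj (𝕜 := ℝ) a).hasMFDerivAt (x := e' (φ x))).comp x
    (h1.hasMFDerivAt.comp x h2.hasMFDerivAt)
  exact DFunLike.congr_fun h3.mfderiv v

/-- A tangent vector is vertical if and only if the components of `φ` in a chart have derivative
zero along it. -/
lemma mfderiv_eq_zero_iff (hφ : ContMDiff (𝓡 m) (𝓡 n) ∞ φ)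
    (he' : e' ∈ IsManifold.maximalAtlas (𝓡 n) ∞ N) {x : M} (hx : φ x ∈ e'.source)
    (v : TangentSpace (𝓡 m) x) :
    mfderiv (𝓡 m) (𝓡 n) φ x v = 0 ↔
      ∀ a, mfderiv (𝓡 m) 𝓘(ℝ, ℝ) (fun z ↦ e' (φ z) a) x v = (0 : ℝ) := by
  have hinj := (mdifferentiable_of_mem_maximalAtlas he').mfderiv_injective hx
  rw [← map_eq_zero_iff _ hinj]
  simp only [mfderiv_coord hφ he' hx]
  exact PiLp.ext_iff

variable [IsManifold (𝓡 m) ∞ M]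

lemma grad_coord_mem_orth (g : Metric m M) (hφ : ContMDiff (𝓡 m) (𝓡 n) ∞ φ)
    (he' : e' ∈ IsManifold.maximalAtlas (𝓡 n) ∞ N) {x : M} (hx : φ x ∈ e'.source) (a : Fin n) :
    grad g (fun z ↦ e' (φ z) a) x ∈ orth g (vertical m n φ x) := by
  rw [mem_orth]
  intro w hw
  rw [g.symm, inner_grad]
  exact (mfderiv_eq_zero_iff hφ he' hx w).1 hw a

lemma contMDiffAt_coordVec (he : e ∈ IsManifold.maximalAtlas (𝓡 m) ∞ M) (hy : y ∈ e.target)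
    (i : Fin m) :
    ContMDiffAt (𝓡 m) (𝓡 m).tangent ∞
      (fun z ↦ (⟨e.symm z, coordVec e z i⟩ : TangentBundle (𝓡 m) M)) y := by
  have h1 := (contMDiffOn_symm_of_mem_maximalAtlas he).contMDiffOn_tangentMapWithin (m := ∞)
    (by simp) e.open_target.uniqueMDiffOn
  have h2 : ContMDiffOn (𝓡 m) (𝓡 m).tangent ∞ (fun z ↦ (⟨z, EuclideanSpace.single i 1⟩ :
      TangentBundle (𝓡 m) (EuclideanSpace ℝ (Fin m)))) e.target :=
    contMDiffOn_vectorSpace_iff_contDiffOn.2 contDiffOn_const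
  refine ((h1.comp h2 fun z hz ↦ hz).congr fun z hz ↦ ?_).contMDiffAt (e.open_target.mem_nhds hy)
  simp only [Function.comp_apply, tangentMapWithin, coordVec]
  rw [mfderivWithin_of_mem_nhds (e.open_target.mem_nhds hz)]

lemma contDiffAt_coordMatrix {G : FormField m M} {W : Set M} (hW : IsOpen W)
    (hG : IsMetricOn G W) (he : e ∈ IsManifold.maximalAtlas (𝓡 m) ∞ M) (hy : y ∈ e.target)
    (hyW : e.symm y ∈ W) (i j : Fin m) :
    ContDiffAt ℝ ∞ (fun z ↦ coordMatrix G e z i j) y := by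
  have h1 := (hG.smooth.contMDiffAt (hW.mem_nhds hyW)).comp y
    (contMDiffAt_symm_of_mem_maximalAtlas he hy)
  have h2 : ContMDiffAt (𝓡 m) ((𝓡 m).prod 𝓘(ℝ)) ∞
      (fun z ↦ TotalSpace.mk' ℝ (E := Bundle.Trivial M ℝ) (e.symm z) (coordMatrix G e z i j))
      y := by
    apply ContMDiffAt.clm_bundle_apply₂ (F₁ := EuclideanSpace ℝ (Fin m))
      (F₂ := EuclideanSpace ℝ (Fin m))
    · exact h1
    · exact contMDiffAt_coordVec he hy i
    · exact contMDiffAt_coordVec he hy j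
  rw [contMDiffAt_totalSpace] at h2
  exact h2.2.contDiffAt

lemma isMetricOn_inner (g : Metric m M) : IsMetricOn g.inner Set.univ :=
  ⟨fun x _ ↦ g.symm x, fun x _ ↦ g.pos x, g.contMDiff.contMDiffOn⟩

lemma isSymm_coordMatrix {G : FormField m M} {W : Set M} (hG : IsMetricOn G W)
    (hyW : e.symm y ∈ W) : (coordMatrix G e y).IsSymm :=
  Matrix.IsSymm.ext fun _ _ ↦ hG.symm _ hyW _ _

lemma det_coordMatrix_ne_zero {G : FormField m M} {W : Set M} (hG : IsMetricOn G W)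
    (he : e ∈ IsManifold.maximalAtlas (𝓡 m) ∞ M) (hy : y ∈ e.target) (hyW : e.symm y ∈ W) :
    (coordMatrix G e y).det ≠ 0 := by
  intro h0
  obtain ⟨c, hc, hc0⟩ := Matrix.exists_mulVec_eq_zero_iff.2 h0
  set v := ∑ j, c j • coordBasis he hy j with hv
  have hv0 : v ≠ 0 := fun h ↦ hc <| funext fun j ↦
    Fintype.linearIndependent_iff.1 (coordBasis he hy).linearIndependent c h j
  refine (hG.pos _ hyW v hv0).ne' ?_
  have h1 (i : Fin m) : G (e.symm y) (coordBasis he hy i) v = 0 := by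
    have := congrFun hc0 i
    simp only [Matrix.mulVec, dotProduct, Pi.zero_apply] at this
    rw [hv, map_sum, ← this]
    refine Finset.sum_congr rfl fun j _ ↦ ?_
    rw [map_smul, smul_eq_mul, mul_comm, coordBasis_apply, coordBasis_apply]
    rfl
  rw [hG.symm _ hyW, hv, map_sum]
  refine Finset.sum_eq_zero fun j _ ↦ ?_
  rw [map_smul, hG.symm _ hyW, ← hv, h1, smul_zero]

/-- The functions `coordGrad` are the components of the gradient in the coordinate basis. -/
lemma sum_coordGrad_smul_coordVec (g : Metric m M) {f : M → ℝ}
    (he : e ∈ IsManifold.maximalAtlas (𝓡 m) ∞ M) (hy : y ∈ e.target)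
    (hf : MDifferentiableAt (𝓡 m) 𝓘(ℝ, ℝ) f (e.symm y)) :
    ∑ i, coordGrad g.inner e (f ∘ e.symm) i y • coordVec e y i = grad g f (e.symm y) := by
  rw [← sub_eq_zero]
  refine (form_nondegenerate g (e.symm y)).1 _ fun w ↦ ?_
  refine LinearMap.congr_fun (g := 0) ((coordBasis he hy).ext fun j ↦ ?_) w
  rw [coordBasis_apply, LinearMap.zero_apply, form_apply, map_sub, sub_apply,
    inner_grad, ← pd_comp_symm he hy hf, sub_eq_zero, map_sum]
  rw [sum_apply]
  have hA : (coordMatrix g.inner e y) *ᵥ ((coordMatrix g.inner e y)⁻¹ *ᵥ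
      fun j ↦ pd j (f ∘ e.symm) y) = fun j ↦ pd j (f ∘ e.symm) y := by
    rw [Matrix.mulVec_mulVec, Matrix.mul_nonsing_inv _ (isUnit_iff_ne_zero.2
      (det_coordMatrix_ne_zero (isMetricOn_inner g) he hy trivial)), Matrix.one_mulVec]
  refine Eq.trans (Finset.sum_congr rfl fun i _ ↦ ?_) (congrFun hA j)
  rw [map_smul, smul_apply, g.symm, smul_eq_mul, mul_comm]
  rfl

variable [IsManifold (𝓡 n) ∞ N]

/-- The regular points of a smooth map form an open set. -/
lemma isOpen_regularSet (hφ : ContMDiff (𝓡 m) (𝓡 n) ∞ φ) : IsOpen (regularSet m n φ) := by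
  rw [isOpen_iff_mem_nhds]
  intro x hx
  set e := chartAt (EuclideanSpace ℝ (Fin m)) x
  set e' := chartAt (EuclideanSpace ℝ (Fin n)) (φ x)
  have he : e ∈ IsManifold.maximalAtlas (𝓡 m) ∞ M := IsManifold.chart_mem_maximalAtlas x
  have he' : e' ∈ IsManifold.maximalAtlas (𝓡 n) ∞ N := IsManifold.chart_mem_maximalAtlas (φ x)
  have hxe : x ∈ e.source := mem_chart_source _ x
  have hxe' : φ x ∈ e'.source := mem_chart_source _ (φ x)
  have hd := mdifferentiable_of_mem_maximalAtlas he
  have hd' := mdifferentiable_of_mem_maximalAtlas he'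
  set u : EuclideanSpace ℝ (Fin m) → EuclideanSpace ℝ (Fin n) := e' ∘ φ ∘ e.symm with hu
  have hsmooth (z : M) (hz : z ∈ e.source) (hz' : φ z ∈ e'.source) : ContDiffAt ℝ ∞ u (e z) := by
    have h2 := contMDiffAt_symm_of_mem_maximalAtlas he (e.map_source hz)
    have h3 : ContMDiffAt (𝓡 n) (𝓡 n) ∞ e' (φ (e.symm (e z))) :=
      contMDiffAt_of_mem_maximalAtlas he' (by rwa [e.left_inv hz])
    exact (h3.comp (e z) ((hφ _).comp (e z) h2)).contDiffAt
  have hfd (z : M) (hz : z ∈ e.source) (hz' : φ z ∈ e'.source) (v : TangentSpace (𝓡 m) z) :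
      fderiv ℝ u (e z) (mfderiv (𝓡 m) (𝓡 m) e z v) =
        mfderiv (𝓡 n) (𝓡 n) e' (φ z) (mfderiv (𝓡 m) (𝓡 n) φ z v) := by
    have h1 := ((hsmooth z hz hz').differentiableAt (by simp)).hasFDerivAt.hasMFDerivAt.comp z
      (hd.mdifferentiableAt hz).hasMFDerivAt
    have h2 : MDifferentiableAt (𝓡 m) (𝓡 n) φ z := hφ.mdifferentiableAt (by simp)
    have h3 := (hd'.mdifferentiableAt hz').hasMFDerivAt.comp z h2.hasMFDerivAt
    have h4 : e' ∘ φ =ᶠ[nhds z] u ∘ e := by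
      filter_upwards [e.open_source.mem_nhds hz] with z' hz'
      simp only [hu, Function.comp_apply, e.left_inv hz']
    exact DFunLike.congr_fun (hasMFDerivAt_unique (h1.congr_of_eventuallyEq h4) h3) v
  have hcont : ContinuousAt (fun z ↦ fderiv ℝ u (e z)) x :=
    ((hsmooth x hxe hxe').fderiv_right (m := ∞) (by simp)).continuousAt.comp (f := e)
      (e.continuousAt hxe)
  have hsurj : Function.Surjective (fderiv ℝ u (e x)) := by
    intro w
    obtain ⟨w', rfl⟩ := hd'.mfderiv_surjective hxe' w
    obtain ⟨v, rfl⟩ := hx w'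
    exact ⟨mfderiv (𝓡 m) (𝓡 m) e x v, hfd x hxe hxe' v⟩
  filter_upwards [hcont (isOpen_setOf_surjective.mem_nhds hsurj), e.open_source.mem_nhds hxe,
    hφ.continuous.continuousAt (e'.open_source.mem_nhds hxe')] with z hz hze hze' w
  obtain ⟨v', hv'⟩ := hz (mfderiv (𝓡 n) (𝓡 n) e' (φ z) w)
  obtain ⟨v, rfl⟩ := hd.mfderiv_surjective hze v'
  exact ⟨v, hd'.mfderiv_injective hze' ((hfd z hze hze' v).symm.trans hv')⟩

end Charts

section Biconformal

variable {m n : ℕ} {M N : Type*}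
  [TopologicalSpace M] [ChartedSpace (EuclideanSpace ℝ (Fin m)) M] [IsManifold (𝓡 m) ∞ M]
  [TopologicalSpace N] [ChartedSpace (EuclideanSpace ℝ (Fin n)) N]
  {e : OpenPartialHomeomorph M (EuclideanSpace ℝ (Fin m))}
  {e' : OpenPartialHomeomorph N (EuclideanSpace ℝ (Fin n))}
  {y : EuclideanSpace ℝ (Fin m)} {φ : M → N} {W : Set M} {G : FormField m M} {σ ρ : M → ℝ}

lemma contMDiffOn_zpow {m : ℕ} {M : Type*} [TopologicalSpace M]
    [ChartedSpace (EuclideanSpace ℝ (Fin m)) M] {W : Set M} {f : M → ℝ}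
    (hf : ContMDiffOn (𝓡 m) 𝓘(ℝ, ℝ) ∞ f W)
    (h0 : ∀ x ∈ W, f x ≠ 0) (k : ℤ) : ContMDiffOn (𝓡 m) 𝓘(ℝ, ℝ) ∞ (fun x ↦ f x ^ k) W := by
  obtain k | k := k
  · simp only [Int.ofNat_eq_natCast, zpow_natCast]
    exact hf.pow k
  · simp only [zpow_negSucc]
    exact (hf.pow (k + 1)).inv₀ fun x hx ↦ pow_ne_zero _ (h0 x hx)

/-! ### Gradients under a biconformal change -/

/-- A function whose gradient is horizontal has its gradient multiplied by `σ²` under a biconformal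
change of metric. -/
lemma coordGrad_biconformal (g : Metric m M) (hG : IsMetricOn G W) {f : M → ℝ}
    (he : e ∈ IsManifold.maximalAtlas (𝓡 m) ∞ M) (hy : y ∈ e.target) (hyW : e.symm y ∈ W)
    (hbi : IsBiconformalAt m n g φ σ ρ G (e.symm y)) (hσ : σ (e.symm y) ≠ 0)
    (hf : MDifferentiableAt (𝓡 m) 𝓘(ℝ, ℝ) f (e.symm y))
    (hgrad : grad g f (e.symm y) ∈ orth g (vertical m n φ (e.symm y))) (i : Fin m) :
    coordGrad G e (f ∘ e.symm) i y =
      σ (e.symm y) ^ 2 * coordGrad g.inner e (f ∘ e.symm) i y := by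
  set ξ : Fin m → ℝ := fun i ↦ coordGrad g.inner e (f ∘ e.symm) i y with hξ
  have h1 : coordMatrix G e y *ᵥ ξ = (σ (e.symm y) ^ 2)⁻¹ • fun j ↦ pd j (f ∘ e.symm) y := by
    ext j
    have h2 := hbi.apply_of_mem_orth g hgrad (coordVec e y j)
    rw [inner_grad, ← pd_comp_symm he hy hf, hG.symm _ hyW,
      ← sum_coordGrad_smul_coordVec g he hy hf, map_sum] at h2
    refine Eq.trans (?_ : _ = ∑ i, _) h2
    rw [Matrix.mulVec, dotProduct]
    refine Finset.sum_congr rfl fun i _ ↦ ?_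
    rw [map_smul, smul_eq_mul, mul_comm]
    rfl
  have h3 : (coordMatrix G e y)⁻¹ *ᵥ (fun j ↦ pd j (f ∘ e.symm) y) = σ (e.symm y) ^ 2 • ξ := by
    have h4 := congrArg ((coordMatrix G e y)⁻¹ *ᵥ ·) h1
    simp only [Matrix.mulVec_mulVec, Matrix.nonsing_inv_mul _ (isUnit_iff_ne_zero.2
      (det_coordMatrix_ne_zero hG he hy hyW)), Matrix.one_mulVec, Matrix.mulVec_smul] at h4
    rw [h4, smul_smul, mul_inv_cancel₀ (pow_ne_zero 2 hσ), one_smul]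
  exact congrFun h3 i

/-- The product of the gradients of `f` and `u`, in coordinates. -/
lemma sum_coordGrad_mul_pd (g : Metric m M) {f u : M → ℝ}
    (he : e ∈ IsManifold.maximalAtlas (𝓡 m) ∞ M) (hy : y ∈ e.target)
    (hf : MDifferentiableAt (𝓡 m) 𝓘(ℝ, ℝ) f (e.symm y))
    (hu : MDifferentiableAt (𝓡 m) 𝓘(ℝ, ℝ) u (e.symm y)) :
    ∑ i, coordGrad g.inner e (f ∘ e.symm) i y * pd i (u ∘ e.symm) y =
      g.inner (e.symm y) (grad g f (e.symm y)) (grad g u (e.symm y)) := by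
  rw [g.symm, inner_grad, ← sum_coordGrad_smul_coordVec g he hy hf, map_sum]
  refine Finset.sum_congr rfl fun i _ ↦ ?_
  rw [map_smul, pd_comp_symm he hy hu]
  rfl

/-! ### Continuity of the tension field -/

lemma continuousAt_christoffel (hW : IsOpen W) (hG : IsMetricOn G W)
    (he : e ∈ IsManifold.maximalAtlas (𝓡 m) ∞ M) (hy : y ∈ e.target) (hyW : e.symm y ∈ W)
    (k i j : Fin m) : ContinuousAt (fun z ↦ christoffel G e z k i j) y := by
  have hA := contDiffAt_coordMatrix hW hG he hy hyW
  have hinv i j := (contDiffAt_inv_apply hA (det_coordMatrix_ne_zero hG he hy hyW) i j).continuousAt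
  have hpd l i j := (contDiffAt_pd (hA i j) l).continuousAt
  unfold christoffel
  exact continuousAt_const.mul <| tendsto_finsetSum _ fun l _ ↦
    (hinv k l).mul (((hpd i j l).add (hpd j i l)).sub (hpd l i j))

variable [IsManifold (𝓡 n) ∞ N]

lemma continuousAt_tension (hW : IsOpen W) (hG : IsMetricOn G W) (h : Metric n N)
    (hφ : ContMDiff (𝓡 m) (𝓡 n) ∞ φ) (he : e ∈ IsManifold.maximalAtlas (𝓡 m) ∞ M)
    (he' : e' ∈ IsManifold.maximalAtlas (𝓡 n) ∞ N) (hy : y ∈ e.target) (hyW : e.symm y ∈ W)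
    (hy' : φ (e.symm y) ∈ e'.source) (a : Fin n) :
    ContinuousAt (fun z ↦ tension G h.inner φ e e' z a) y := by
  have hA := contDiffAt_coordMatrix hW hG he hy hyW
  have hinv i j := (contDiffAt_inv_apply hA (det_coordMatrix_ne_zero hG he hy hyW) i j).continuousAt
  have hu a := contDiffAt_coordMap hφ he hy he' hy' a
  have hpd a i := contDiffAt_pd (hu a) i
  have hΓ k i j := continuousAt_christoffel hW hG he hy hyW k i j
  have hΓ' b c : ContinuousAt (fun z ↦ christoffel h.inner e' (e' (φ (e.symm z))) a b c) y := by
    have h1 := continuousAt_christoffel isOpen_univ (isMetricOn_inner h) he'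
      (e'.map_source hy') trivial a b c
    have h2 : ContinuousAt (fun z ↦ e' (φ (e.symm z))) y :=
      ContinuousAt.comp (g := e') (f := φ ∘ e.symm) (e'.continuousAt hy')
        (ContinuousAt.comp (g := φ) (f := e.symm) hφ.continuous.continuousAt
          (e.symm.continuousAt (x := y) hy))
    exact h1.comp (f := fun z ↦ e' (φ (e.symm z))) h2
  unfold tension
  refine tendsto_finsetSum _ fun i _ ↦ tendsto_finsetSum _ fun j _ ↦ (hinv i j).mul ?_
  refine ((contDiffAt_pd (hpd a j) i).continuousAt.sub ?_).add ?_
  · exact tendsto_finsetSum _ fun k _ ↦ (hΓ k i j).mul (hpd a k).continuousAt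
  · exact tendsto_finsetSum _ fun b _ ↦ tendsto_finsetSum _ fun c _ ↦
      ((hΓ' b c).mul (hpd b i).continuousAt).mul (hpd c j).continuousAt

/-! ### The tension field under a biconformal change -/

/-- The change of the tension field at a regular point, with `C = σ^(-n) ρ^(n-m)` the ratio, up to
sign, of the volume densities. -/
lemma tension_biconformal_density (g : Metric m M) (h : Metric n N)
    (hφ : ContMDiff (𝓡 m) (𝓡 n) ∞ φ) (hW : IsOpen W) (hreg : regularSet m n φ ⊆ W)
    (hσ : ContMDiffOn (𝓡 m) 𝓘(ℝ, ℝ) ∞ σ W) (hσ0 : ∀ x ∈ W, σ x ≠ 0)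
    (hρ : ContMDiffOn (𝓡 m) 𝓘(ℝ, ℝ) ∞ ρ W) (hρ0 : ∀ x ∈ W, ρ x ≠ 0)
    (hG : IsMetricOn G W)
    (hbi : ∀ x ∈ regularSet m n φ, IsBiconformalAt m n g φ σ ρ G x)
    (he : e ∈ IsManifold.maximalAtlas (𝓡 m) ∞ M) (he' : e' ∈ IsManifold.maximalAtlas (𝓡 n) ∞ N)
    (hy : y ∈ e.target) (hx : e.symm y ∈ regularSet m n φ) (hxe' : φ (e.symm y) ∈ e'.source)
    {C : M → ℝ} (hC : C = fun y ↦ σ y ^ (-n : ℤ) * ρ y ^ ((n : ℤ) - m)) (a : Fin n) :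
    tension G h.inner φ e e' y a = σ (e.symm y) ^ 2 * (tension g.inner h.inner φ e e' y a +
      (σ (e.symm y) ^ 2 * C (e.symm y))⁻¹ * ∑ i, coordGrad g.inner e (coordMap φ e e' a) i y *
        pd i (fun z ↦ (σ ∘ e.symm) z ^ 2 * (C ∘ e.symm) z) y) := by
  have hyW := hreg hx
  have hdiff {f : M → ℝ} (hf : ContMDiffOn (𝓡 m) 𝓘(ℝ, ℝ) ∞ f W) :
      DifferentiableAt ℝ (f ∘ e.symm) y :=
    (contDiffAt_comp_symm hW hf he hy hyW).differentiableAt (by simp)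
  have hCs : ContMDiffOn (𝓡 m) 𝓘(ℝ, ℝ) ∞ C W :=
    hC ▸ (contMDiffOn_zpow hσ hσ0 _).mul (contMDiffOn_zpow hρ hρ0 _)
  have hC0 : C (e.symm y) ≠ 0 :=
    hC ▸ mul_ne_zero (zpow_ne_zero _ (hσ0 _ hyW)) (zpow_ne_zero _ (hρ0 _ hyW))
  have hcont : ContinuousAt e.symm y := e.symm.continuousAt (x := y) hy
  have hnear : ∀ᶠ z in nhds y, z ∈ e.target ∧ e.symm z ∈ regularSet m n φ ∧
      φ (e.symm z) ∈ e'.source := by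
    filter_upwards [e.open_target.mem_nhds hy,
      hcont ((isOpen_regularSet hφ).mem_nhds hx),
      (hφ.continuous.continuousAt.comp hcont) (e'.open_source.mem_nhds hxe')] with z h1 h2 h3
    exact ⟨h1, h2, h3⟩
  have hgrad (a : Fin n) (i : Fin m) : ∀ᶠ z in nhds y, coordGrad G e (coordMap φ e e' a) i z =
      (σ ∘ e.symm) z ^ 2 * coordGrad g.inner e (coordMap φ e e' a) i z := by
    filter_upwards [hnear] with z ⟨hz, hzR, hze'⟩
    exact coordGrad_biconformal g hG he hz (hreg hzR) (hbi _ hzR) (hσ0 _ (hreg hzR))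
      ((contMDiffAt_coord hφ he' hze' a).mdifferentiableAt (by simp))
      (grad_coord_mem_orth g hφ he' hze' a) i
  have hvol : ∀ᶠ z in nhds y, (coordMatrix G e z).det =
      (C ∘ e.symm) z ^ 2 * (coordMatrix g.inner e z).det := by
    filter_upwards [hnear] with z ⟨hz, hzR, hze'⟩
    have := (hbi _ hzR).det_gram g hzR (coordBasis he hz)
    simp only [coordBasis_apply] at this
    rw [hC]
    exact this
  have hg := isMetricOn_inner g
  have hA i j := (contDiffAt_coordMatrix isOpen_univ hg he hy trivial i j).of_le
    (show (1 : WithTop ℕ∞) ≤ ∞ by simp)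
  have hA' i j := (contDiffAt_coordMatrix hW hG he hy hyW i j).of_le
    (show (1 : WithTop ℕ∞) ≤ ∞ by simp)
  exact tension_change hA (isSymm_coordMatrix hg trivial)
    (det_coordMatrix_ne_zero hg he hy trivial) hA' (isSymm_coordMatrix hG hyW)
    (det_coordMatrix_ne_zero hG he hy hyW)
    (fun a j ↦ (contDiffAt_pd (contDiffAt_coordMap hφ he hy he' hxe' a) j).differentiableAt
      (by simp)) (hdiff hσ) (hdiff hCs) (hσ0 _ hyW) hC0 hgrad hvol a

/-- The fundamental identity `τ̄ = σ² (τ - dφ(grad log F))` at the regular points, where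
`F = ρ^(m-n) σ^(n-2)`, for the component of `φ` in a chart. -/
lemma tension_biconformal (g : Metric m M) (h : Metric n N) (hφ : ContMDiff (𝓡 m) (𝓡 n) ∞ φ)
    (hW : IsOpen W) (hreg : regularSet m n φ ⊆ W)
    (hσ : ContMDiffOn (𝓡 m) 𝓘(ℝ, ℝ) ∞ σ W) (hσ0 : ∀ x ∈ W, σ x ≠ 0)
    (hρ : ContMDiffOn (𝓡 m) 𝓘(ℝ, ℝ) ∞ ρ W) (hρ0 : ∀ x ∈ W, ρ x ≠ 0)
    (hG : IsMetricOn G W)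
    (hbi : ∀ x ∈ regularSet m n φ, IsBiconformalAt m n g φ σ ρ G x)
    (he : e ∈ IsManifold.maximalAtlas (𝓡 m) ∞ M) (he' : e' ∈ IsManifold.maximalAtlas (𝓡 n) ∞ N)
    {x : M} (hx : x ∈ regularSet m n φ) (hxe : x ∈ e.source) (hxe' : φ x ∈ e'.source)
    {F : M → ℝ} (hF : F = fun y ↦ ρ y ^ ((m : ℤ) - (n : ℤ)) * σ y ^ ((n : ℤ) - 2)) (a : Fin n) :
    tension G h.inner φ e e' (e x) a = σ x ^ 2 * (tension g.inner h.inner φ e e' (e x) a -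
      (F x)⁻¹ * g.inner x (grad g (fun z ↦ e' (φ z) a) x) (grad g F x)) := by
  obtain ⟨y, hy, hyx⟩ : ∃ y ∈ e.target, e.symm y = x :=
    ⟨e x, e.map_source hxe, e.left_inv hxe⟩
  subst hyx
  rw [e.right_inv hy]
  have hyW := hreg hx
  obtain ⟨C, hC⟩ : ∃ C : M → ℝ, C = fun y ↦ σ y ^ (-n : ℤ) * ρ y ^ ((n : ℤ) - m) := ⟨_, rfl⟩
  have hFs : ContMDiffOn (𝓡 m) 𝓘(ℝ, ℝ) ∞ F W :=
    hF ▸ (contMDiffOn_zpow hρ hρ0 _).mul (contMDiffOn_zpow hσ hσ0 _)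
  have hCs : ContMDiffOn (𝓡 m) 𝓘(ℝ, ℝ) ∞ (fun x ↦ σ x ^ 2 * C x) W :=
    (hσ.pow 2).mul (hC ▸ (contMDiffOn_zpow hσ hσ0 _).mul (contMDiffOn_zpow hρ hρ0 _))
  have hFC (x : M) (hx : x ∈ W) : σ x ^ 2 * C x * F x = 1 := by
    have h1 : σ x ^ 2 * C x * F x = (σ x ^ (2 : ℤ) * σ x ^ (-n : ℤ) * σ x ^ ((n : ℤ) - 2)) *
        (ρ x ^ ((n : ℤ) - m) * ρ x ^ ((m : ℤ) - n)) := by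
      simp only [hC, hF, zpow_ofNat]
      ring
    rw [h1, ← zpow_add₀ (hσ0 x hx), ← zpow_add₀ (hσ0 x hx), ← zpow_add₀ (hρ0 x hx)]
    simp [show (2 : ℤ) + -n + (n - 2) = 0 by ring]
  have hdiff {f : M → ℝ} (hf : ContMDiffOn (𝓡 m) 𝓘(ℝ, ℝ) ∞ f W) :
      DifferentiableAt ℝ (f ∘ e.symm) y :=
    (contDiffAt_comp_symm hW hf he hy hyW).differentiableAt (by simp)
  have hFC' := hFC _ hyW
  have hσC : DifferentiableAt ℝ (fun z ↦ (σ ∘ e.symm) z ^ 2 * (C ∘ e.symm) z) y := hdiff hCs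
  -- `σ² C = F⁻¹`, hence `∂ᵢ (σ² C) = -(σ² C) F⁻¹ ∂ᵢ F`.
  have hpd (i : Fin m) : pd i (fun z ↦ (σ ∘ e.symm) z ^ 2 * (C ∘ e.symm) z) y =
      -(σ (e.symm y) ^ 2 * C (e.symm y)) * ((F (e.symm y))⁻¹ * pd i (F ∘ e.symm) y) := by
    have h1 : pd i (fun z ↦ (σ ∘ e.symm) z ^ 2 * (C ∘ e.symm) z * (F ∘ e.symm) z) y = 0 := by
      rw [← pd_const (y := y) i 1]
      refine pd_congr i ?_
      filter_upwards [(e.symm.continuousAt (x := y) hy) (hW.mem_nhds hyW)] with z hz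
      exact hFC _ hz
    rw [pd_mul i hσC (hdiff hFs)] at h1
    have h2 := right_ne_zero_of_mul_eq_one hFC'
    have h3 := eq_neg_of_add_eq_zero_left h1
    simp only [Function.comp_apply] at h3 ⊢
    rw [← mul_div_cancel_right₀ (pd i _ y) h2, h3]
    field_simp
  have hsum : ∑ i, coordGrad g.inner e (coordMap φ e e' a) i y * pd i (F ∘ e.symm) y =
      g.inner (e.symm y) (grad g (fun z ↦ e' (φ z) a) (e.symm y)) (grad g F (e.symm y)) :=
    sum_coordGrad_mul_pd g (f := fun z ↦ e' (φ z) a) (u := F) he hy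
      ((contMDiffAt_coord hφ he' hxe' a).mdifferentiableAt (by simp))
      ((hFs.contMDiffAt (hW.mem_nhds hyW)).mdifferentiableAt (by simp))
  have hsum' : ∑ i, coordGrad g.inner e (coordMap φ e e' a) i y *
        pd i (fun z ↦ (σ ∘ e.symm) z ^ 2 * (C ∘ e.symm) z) y =
      -(σ (e.symm y) ^ 2 * C (e.symm y)) * ((F (e.symm y))⁻¹ *
        ∑ i, coordGrad g.inner e (coordMap φ e e' a) i y * pd i (F ∘ e.symm) y) := by
    simp only [hpd, Finset.mul_sum]
    refine Finset.sum_congr rfl fun i _ ↦ ?_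
    ring
  rw [tension_biconformal_density g h hφ hW hreg hσ hσ0 hρ hρ0 hG hbi he he' hy hx hxe' hC a,
    hsum', hsum, neg_mul, mul_neg, inv_mul_cancel_left₀ (left_ne_zero_of_mul_eq_one hFC'),
    ← sub_eq_add_neg]

end Biconformal

/-! ### Density of the regular points -/

section Density

variable {m n : ℕ} {M N : Type*}
  [TopologicalSpace M] [ChartedSpace (EuclideanSpace ℝ (Fin m)) M] [IsManifold (𝓡 m) ∞ M]
  [TopologicalSpace N] [ChartedSpace (EuclideanSpace ℝ (Fin n)) N]
  {e : OpenPartialHomeomorph M (EuclideanSpace ℝ (Fin m))}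
  {e' : OpenPartialHomeomorph N (EuclideanSpace ℝ (Fin n))} {φ : M → N}

/-- The condition `grad^H u = 0` at a point, expressed by the components of `φ` in a chart: unlike
the projection onto the horizontal space, these expressions are continuous in the point. -/
lemma horPart_grad_eq_zero_iff (g : Metric m M) (hφ : ContMDiff (𝓡 m) (𝓡 n) ∞ φ)
    (he' : e' ∈ IsManifold.maximalAtlas (𝓡 n) ∞ N) {x : M} (hx : φ x ∈ e'.source) (u : M → ℝ) :
    horPart m n g φ x (grad g u x) = 0 ↔
      ∀ a, g.inner x (grad g (fun z ↦ e' (φ z) a) x) (grad g u x) = 0 := by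
  rw [horPart_eq_zero_iff, mfderiv_eq_zero_iff hφ he' hx]
  refine forall_congr' fun a ↦ ?_
  rw [inner_grad]
  exact Iff.rfl

lemma continuousAt_inner_grad (g : Metric m M) {O : Set M} (hO : IsOpen O) {f u : M → ℝ}
    (hf : ContMDiffOn (𝓡 m) 𝓘(ℝ, ℝ) ∞ f O) (hu : ContMDiffOn (𝓡 m) 𝓘(ℝ, ℝ) ∞ u O)
    {x : M} (hx : x ∈ O) : ContinuousAt (fun z ↦ g.inner z (grad g f z) (grad g u z)) x := by
  set e := chartAt (EuclideanSpace ℝ (Fin m)) x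
  have he : e ∈ IsManifold.maximalAtlas (𝓡 m) ∞ M := IsManifold.chart_mem_maximalAtlas x
  have hxe : x ∈ e.source := mem_chart_source _ x
  have hy := e.map_source hxe
  have hyO : e.symm (e x) ∈ O := by rwa [e.left_inv hxe]
  have hA := contDiffAt_coordMatrix isOpen_univ (isMetricOn_inner g) he hy trivial
  have hinv i j := (contDiffAt_inv_apply hA
    (det_coordMatrix_ne_zero (isMetricOn_inner g) he hy trivial) i j).continuousAt
  have h1 : ContinuousAt (fun y ↦ ∑ i, coordGrad g.inner e (f ∘ e.symm) i y *
      pd i (u ∘ e.symm) y) (e x) := by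
    unfold coordGrad
    exact tendsto_finsetSum _ fun i _ ↦ (tendsto_finsetSum _ fun j _ ↦ (hinv i j).mul
      (contDiffAt_pd (contDiffAt_comp_symm hO hf he hy hyO) j).continuousAt).mul
      (contDiffAt_pd (contDiffAt_comp_symm hO hu he hy hyO) i).continuousAt
  refine (ContinuousAt.comp (f := e) h1 (e.continuousAt hxe)).congr ?_
  filter_upwards [e.open_source.mem_nhds hxe, hO.mem_nhds hx] with z hz hzO
  have h2 := sum_coordGrad_mul_pd g (f := f) (u := u) he (e.map_source hz)
    (by rw [e.left_inv hz]; exact (hf.contMDiffAt (hO.mem_nhds hzO)).mdifferentiableAt (by simp))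
    (by rw [e.left_inv hz]; exact (hu.contMDiffAt (hO.mem_nhds hzO)).mdifferentiableAt (by simp))
  rw [e.left_inv hz] at h2
  exact h2

/-- A continuous function that vanishes on a dense set vanishes. -/
lemma eq_zero_of_dense {R O : Set M} (hR : Dense R) (hO : IsOpen O) {f : M → ℝ}
    (hf : ∀ x ∈ O, ContinuousAt f x) (h0 : ∀ x ∈ O, x ∈ R → f x = 0) {x : M} (hx : x ∈ O) :
    f x = 0 :=
  Set.EqOn.of_subset_closure (s := O ∩ R) (t := O) (g := fun _ ↦ 0)
    (fun z hz ↦ h0 z hz.1 hz.2) (fun z hz ↦ (hf z hz).continuousWithinAt) continuousOn_const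
    Set.inter_subset_left (hR.open_subset_closure_inter hO) hx

variable [IsManifold (𝓡 n) ∞ N]

/-- In order that a map be harmonic on an open set, it is enough that its tension field vanishes on
a dense set. -/
lemma isHarmonicOn_of_dense {G : FormField m M} {W R : Set M} (hW : IsOpen W)
    (hG : IsMetricOn G W) (h : Metric n N) (hφ : ContMDiff (𝓡 m) (𝓡 n) ∞ φ) (hR : Dense R)
    (h0 : ∀ e ∈ IsManifold.maximalAtlas (𝓡 m) ∞ M, ∀ e' ∈ IsManifold.maximalAtlas (𝓡 n) ∞ N,
      ∀ x ∈ R, x ∈ W → x ∈ e.source → φ x ∈ e'.source →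
        ∀ a, tension G h.inner φ e e' (e x) a = 0) :
    IsHarmonicOn G h.inner φ W := by
  intro e he e' he' x hx hxe hxe' a
  refine eq_zero_of_dense (f := fun z ↦ tension G h.inner φ e e' (e z) a)
    (O := W ∩ e.source ∩ φ ⁻¹' e'.source) hR
    ((hW.inter e.open_source).inter (e'.open_source.preimage hφ.continuous)) ?_ ?_
    ⟨⟨hx, hxe⟩, hxe'⟩
  · rintro z ⟨⟨hzW, hze⟩, hze'⟩
    refine ContinuousAt.comp (f := e) (g := fun y ↦ tension G h.inner φ e e' y a)
      (continuousAt_tension hW hG h hφ he he' (e.map_source hze) ?_ ?_ a) (e.continuousAt hze)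
    · rwa [e.left_inv hze]
    · rwa [e.left_inv hze]
  · rintro z ⟨⟨hzW, hze⟩, hze'⟩ hzR
    exact h0 e he e' he' z hzR hzW hze hze' a

end Density

end AlmostSubmersion

open AlmostSubmersion in
theorem mainTheorem4 {m n : ℕ} {M N : Type*}
    [TopologicalSpace M] [ChartedSpace (EuclideanSpace ℝ (Fin m)) M] [IsManifold (𝓡 m) ∞ M]
    [TopologicalSpace N] [ChartedSpace (EuclideanSpace ℝ (Fin n)) N] [IsManifold (𝓡 n) ∞ N]
    (g : Metric m M) (h : Metric n N)
    (φ : M → N) (hφ : ContMDiff (𝓡 m) (𝓡 n) ∞ φ) (hsub : Dense (regularSet m n φ))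
    (W : Set M) (hW : IsOpen W) (hreg : regularSet m n φ ⊆ W)
    (σ ρ : M → ℝ)
    (hσ : ContMDiffOn (𝓡 m) 𝓘(ℝ, ℝ) ∞ σ W) (hσ0 : ∀ x ∈ W, σ x ≠ 0)
    (hρ : ContMDiffOn (𝓡 m) 𝓘(ℝ, ℝ) ∞ ρ W) (hρ0 : ∀ x ∈ W, ρ x ≠ 0)
    (gbar : FormField m M) (hgbar : IsMetricOn gbar W)
    (hbi : ∀ x ∈ regularSet m n φ, IsBiconformalAt m n g φ σ ρ gbar x) :
    (IsHarmonicOn g.inner h.inner φ Set.univ ∧ IsHarmonicOn gbar h.inner φ W →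
      HorGradVanishesOn m n g φ σ ρ W) ∧
    (IsHarmonicOn g.inner h.inner φ Set.univ ∧ HorGradVanishesOn m n g φ σ ρ W →
      IsHarmonicOn gbar h.inner φ W) ∧
    (IsHarmonicOn gbar h.inner φ W ∧ HorGradVanishesOn m n g φ σ ρ W →
      IsHarmonicOn g.inner h.inner φ Set.univ) := by
  set F : M → ℝ := fun y ↦ ρ y ^ ((m : ℤ) - (n : ℤ)) * σ y ^ ((n : ℤ) - 2) with hF
  have hFs : ContMDiffOn (𝓡 m) 𝓘(ℝ, ℝ) ∞ F W :=
    (contMDiffOn_zpow hρ hρ0 _).mul (contMDiffOn_zpow hσ hσ0 _)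
  have hF0 (x : M) (hx : x ∈ W) : F x ≠ 0 :=
    mul_ne_zero (zpow_ne_zero _ (hρ0 x hx)) (zpow_ne_zero _ (hσ0 x hx))
  have key {e} (he : e ∈ IsManifold.maximalAtlas (𝓡 m) ∞ M) {e'}
      (he' : e' ∈ IsManifold.maximalAtlas (𝓡 n) ∞ N) {x : M} (hx : x ∈ regularSet m n φ)
      (hxe : x ∈ e.source) (hxe' : φ x ∈ e'.source) (a : Fin n) :=
    tension_biconformal g h hφ hW hreg hσ hσ0 hρ hρ0 hgbar hbi he he' hx hxe hxe' hF a
  refine ⟨fun ⟨h1, h2⟩ x hx ↦ ?_, fun ⟨h1, h3⟩ ↦ ?_, fun ⟨h2, h3⟩ ↦ ?_⟩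
  · set e' := chartAt (EuclideanSpace ℝ (Fin n)) (φ x)
    have he' : e' ∈ IsManifold.maximalAtlas (𝓡 n) ∞ N := IsManifold.chart_mem_maximalAtlas (φ x)
    have hxe' : φ x ∈ e'.source := mem_chart_source _ (φ x)
    refine (horPart_grad_eq_zero_iff g hφ he' hxe' F).2 fun a ↦ ?_
    have hO : IsOpen (W ∩ φ ⁻¹' e'.source) :=
      hW.inter (e'.open_source.preimage hφ.continuous)
    refine eq_zero_of_dense
      (f := fun z ↦ g.inner z (grad g (fun z ↦ e' (φ z) a) z) (grad g F z)) hsub hO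
      (fun z hz ↦ continuousAt_inner_grad g hO
        (fun w hw ↦ (contMDiffAt_coord hφ he' hw.2 a).contMDiffWithinAt)
        (hFs.mono Set.inter_subset_left) hz) (fun z hz hzR ↦ ?_) ⟨hx, hxe'⟩
    have he := IsManifold.chart_mem_maximalAtlas (I := 𝓡 m) (n := ∞) z
    have hze := mem_chart_source (EuclideanSpace ℝ (Fin m)) z
    have h4 := key he he' hzR hze hz.2 a
    rw [h2 _ he _ he' z hz.1 hze hz.2 a, h1 _ he _ he' z trivial hze hz.2 a, zero_sub, eq_comm,
      mul_eq_zero, neg_eq_zero, mul_eq_zero] at h4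
    exact (h4.resolve_left (pow_ne_zero 2 (hσ0 z hz.1))).resolve_left (inv_ne_zero (hF0 z hz.1))
  · refine isHarmonicOn_of_dense hW hgbar h hφ hsub fun e he e' he' x hxR hx hxe hxe' a ↦ ?_
    rw [key he he' hxR hxe hxe' a, h1 e he e' he' x trivial hxe hxe' a,
      (horPart_grad_eq_zero_iff g hφ he' hxe' F).1 (h3 x hx) a]
    simp
  · refine isHarmonicOn_of_dense isOpen_univ (isMetricOn_inner g) h hφ hsub
      fun e he e' he' x hxR _ hxe hxe' a ↦ ?_
    have hx := hreg hxR
    have h4 := key he he' hxR hxe hxe' a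
    rw [h2 e he e' he' x hx hxe hxe' a,
      (horPart_grad_eq_zero_iff g hφ he' hxe' F).1 (h3 x hx) a, mul_zero, sub_zero, eq_comm] at h4
    exact (mul_eq_zero.1 h4).resolve_left (pow_ne_zero 2 (hσ0 x hx))
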